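/- Let $k$ be a field; all Hopf algebras are over $k$ and have bijective antipode, and morphisms, isomorphisms and automorphisms of Hopf algebras are Hopf algebra maps. Let $$1\to B\xrightarrow{\iota}A\xrightarrow{\pi}H\to 1$$ be an exact sequence of Hopf algebras, that is, $\iota$ is injective, $\pi$ is surjective, $\ker\pi=A\,\iota(B^{+})$ with $B^{+}=\ker\varepsilon$, and $\iota(B)=\{a\in A:(\pi\otimes\mathrm{id})\Delta(a)=1\otimes a\}$. Assume that $\iota(B)$ is central in $A$, that $A$ is noetherian, and that (L) for every $f\in\mathrm{Aut}(H)$ there is $F\in\mathrm{Aut}(A)$ with $\pi F=f\pi$; (Z) the Hopf center of $H$ (its largest central Hopf subalgebra) is $k$. Let $\mathrm{qAut}(B)$ be the subgroup of $\mathrm{Aut}(B)$ generated by all $g\in\mathrm{Aut}(B)$ for which there are $f\in\mathrm{Aut}(H)$ and $F\in\mathrm{Aut}(A)$ with $\pi F=f\pi$ and $F\iota=\iota g$. For $i=1,2$ let $p_i:B\to K_i$ be a surjective Hopf algebra map, let $A_i=A/(\iota(\ker p_i))$ be the corresponding pushout Hopf algebra, $q_i:A\to A_i$ the projection and $j_i:K_i\to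 A_i$ the Hopf algebra map with $j_ip_i=q_i\iota$. Then $A_1$ and $A_2$ are isomorphic as Hopf algebras if and only if there is a triple $(\underline{\omega},g,u)$ such that (a) $\underline{\omega}:K_1\to K_2$ is an isomorphism of Hopf algebras; (b) $g\in\mathrm{qAut}(B)$; (c) $u:A\to K_2$ is an algebra map, and there are $\overline{\omega}\in\mathrm{Aut}(H)$ and $F\in\mathrm{Aut}(A)$ with $\pi F=\overline{\omega}\pi$ and $F\iota=\iota g$, such that for all $b\in B$ and $a\in A$ $$\underline{\omega}(p_1(b))=p_2(g(b_{(1)}))\,u(\iota(b_{(2)})),$$ $$\Delta(u(a))=u(a_{(2)})\otimes q_2\bigl(F(\mathcal S(a_{(1)})a_{(3)})\bigr)\,u(a_{(4)}),$$ where in the second identity $K_2$ is mapped to $A_2$ by $j_2$ and the identity is read in $A_2\otimes A_2$. -/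

import Mathlib

open TensorProduct Coalgebra HopfAlgebra

universe u v w

/-- The group of Hopf algebra automorphisms: `f * g` is `f ∘ g`, and `f⁻¹` is the inverse map. -/
instance BialgEquiv.instGroupAut {k : Type u} {A : Type v} [CommSemiring k] [Semiring A]
    [Bialgebra k A] : Group (A ≃ₐc[k] A) where
  mul f g := g.trans f
  one := BialgEquiv.refl k A
  inv f := f.symm
  mul_assoc _ _ _ := rfl
  one_mul _ := rfl
  mul_one _ := rfl
  inv_mul_cancel f := BialgEquiv.ext fun x => f.symm_apply_apply x

namespace HopfExt

section Center

/-- `D` is a Hopf subalgebra of `A`: a subalgebra with `Δ(D) ⊆ D ⊗ D` and `S(D) ⊆ D`. -/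
structure IsHopfSubalgebra {k : Type u} {A : Type v} [Field k] [Ring A] [HopfAlgebra k A]
    (D : Subalgebra k A) : Prop where
  comul_mem : ∀ x ∈ D, comul (R := k) x ∈
    LinearMap.range (TensorProduct.map D.val.toLinearMap D.val.toLinearMap)
  antipode_mem : ∀ x ∈ D, antipode k x ∈ D

/-- `D` is a Hopf subalgebra of `A` contained in the center of `A`. -/
structure IsCentralHopfSubalgebra {k : Type u} {A : Type v} [Field k] [Ring A] [HopfAlgebra k A]
    (D : Subalgebra k A) : Prop extends IsHopfSubalgebra D where
  le_center : D ≤ Subalgebra.center k A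

/-- The Hopf center: the supremum of all central Hopf subalgebras. It is the largest of them, see
`isGreatest_hopfCenter`. -/
noncomputable def hopfCenter (k : Type u) (A : Type v) [Field k] [Ring A] [HopfAlgebra k A] :
    Subalgebra k A :=
  sSup {D : Subalgebra k A | IsCentralHopfSubalgebra D}

theorem isGreatest_hopfCenter (k : Type u) (A : Type v) [Field k] [Ring A] [HopfAlgebra k A] :
    IsGreatest {D : Subalgebra k A | IsCentralHopfSubalgebra D} (hopfCenter k A) := by
  have hle : ∀ D : Subalgebra k A, IsCentralHopfSubalgebra D → D ≤ hopfCenter k A :=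
    fun D hD => le_sSup hD
  refine ⟨⟨⟨?_, ?_⟩, sSup_le fun D hD => hD.le_center⟩, fun D hD => hle D hD⟩
  · set Z := hopfCenter k A with hZ
    let T : Subalgebra k (A ⊗[k] A) := (Algebra.TensorProduct.map Z.val Z.val).range
    have key : Z ≤ T.comap (Bialgebra.comulAlgHom k A) := by
      rw [hZ]
      refine sSup_le fun D hD x hx => ?_
      obtain ⟨t, ht⟩ := hD.comul_mem x hx
      refine ⟨Algebra.TensorProduct.map (Subalgebra.inclusion (hle D hD))
        (Subalgebra.inclusion (hle D hD)) t, ?_⟩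
      have hc : (Algebra.TensorProduct.map Z.val Z.val).comp
          (Algebra.TensorProduct.map (Subalgebra.inclusion (hle D hD))
            (Subalgebra.inclusion (hle D hD))) = Algebra.TensorProduct.map D.val D.val := by
        ext <;> rfl
      exact (DFunLike.congr_fun hc t).trans ht
    intro x hx
    obtain ⟨t, ht⟩ := key hx
    exact ⟨t, ht⟩
  · intro x hx
    have hx' : x ∈ Algebra.adjoin k
        (⋃ D ∈ {D : Subalgebra k A | IsCentralHopfSubalgebra D}, (D : Set A)) := by
      have := hx
      rwa [hopfCenter, Algebra.sSup_def, Set.sUnion_image] at this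
    induction hx' using Algebra.adjoin_induction with
    | mem y hy =>
      simp only [Set.mem_iUnion] at hy
      obtain ⟨D, hD, hy⟩ := hy
      exact hle D hD (hD.antipode_mem y hy)
    | algebraMap r =>
      rw [Algebra.algebraMap_eq_smul_one, map_smul, antipode_one]
      exact Subalgebra.smul_mem _ (one_mem _) r
    | add y z hy hz ihy ihz =>
      rw [map_add]
      exact add_mem (ihy (by rwa [hopfCenter, Algebra.sSup_def, Set.sUnion_image]))
        (ihz (by rwa [hopfCenter, Algebra.sSup_def, Set.sUnion_image]))
    | mul y z hy hz ihy ihz =>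
      rw [antipode_mul_antidistrib]
      exact mul_mem (ihz (by rwa [hopfCenter, Algebra.sSup_def, Set.sUnion_image]))
        (ihy (by rwa [hopfCenter, Algebra.sSup_def, Set.sUnion_image]))

end Center

section Extension

variable {k : Type u} {B A H : Type*} [Field k] [Ring B] [HopfAlgebra k B] [Ring A]
  [HopfAlgebra k A] [Ring H] [HopfAlgebra k H]

/-- The sequence `1 → B → A → H → 1` of Hopf algebra maps is exact: `ι` is injective, `π` is
surjective, `ker π = A ι(B)⁺` (the left ideal spanned by `ι(B⁺)`), and `ι(B)` is the algebra of
left coinvariants `{a | (π ⊗ id) Δ(a) = 1 ⊗ a}`. -/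
structure IsExactSeq (ι : B →ₐc[k] A) (π : A →ₐc[k] H) : Prop where
  injective : Function.Injective ι
  surjective : Function.Surjective π
  ker_eq : RingHom.ker π = Ideal.span (ι '' {b : B | counit (R := k) b = 0})
  range_eq : Set.range ι = {a : A |
    TensorProduct.map (π : A →ₗ[k] H) LinearMap.id (comul (R := k) a) = (1 : H) ⊗ₜ[k] a}

/-- The extension is central: `ι(B)` lies in the center of `A`. -/
def IsCentralMap (ι : B →ₐc[k] A) : Prop := ∀ (b : B) (a : A), ι b * a = a * ι b

/-- `F ∈ Aut(A)` lifts `f ∈ Aut(H)`: `π F = f π`. -/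
def IsLift (π : A →ₐc[k] H) (f : H ≃ₐc[k] H) (F : A ≃ₐc[k] A) : Prop :=
  ∀ a : A, π (F a) = f (π a)

/-- Condition (L): every Hopf algebra automorphism of `H` lifts to one of `A`. -/
def ConditionL (π : A →ₐc[k] H) : Prop :=
  ∀ f : H ≃ₐc[k] H, ∃ F : A ≃ₐc[k] A, IsLift π f F

/-- Condition (Z): the Hopf center of `H` is trivial. -/
def ConditionZ (k : Type u) (H : Type v) [Field k] [Ring H] [HopfAlgebra k H] : Prop :=
  hopfCenter k H = ⊥

/-- `qAut(B)`: the subgroup of the group of Hopf algebra automorphisms of `B` generated by the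
restrictions `g` to `B` of the lifts `F` to `A` of automorphisms `f` of `H`. -/
def qAut (ι : B →ₐc[k] A) (π : A →ₐc[k] H) : Subgroup (B ≃ₐc[k] B) :=
  Subgroup.closure {g | ∃ (f : H ≃ₐc[k] H) (F : A ≃ₐc[k] A),
    IsLift π f F ∧ ∀ b : B, F (ι b) = ι (g b)}

end Extension

section Antipode

/-- A bialgebra map between Hopf algebras commutes with the antipodes. -/
theorem antipode_map {k : Type u} {A B : Type*} [CommRing k] [Ring A] [HopfAlgebra k A] [Ring B]
    [HopfAlgebra k B] (f : B →ₐc[k] A) (b : B) : f (antipode k b) = antipode k (f b) := by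
  let fl : B →ₗ[k] A := (AlgHomClass.toAlgHom f).toLinearMap
  let φ : WithConv (B →ₗ[k] A) := .toConv fl
  let l : WithConv (B →ₗ[k] A) := .toConv (fl ∘ₗ antipode k)
  let r : WithConv (B →ₗ[k] A) := .toConv (antipode k ∘ₗ fl)
  have h1 : l * φ = 1 := by
    apply WithConv.ofConv_injective
    calc (l * φ).ofConv = fl ∘ₗ
          (.toConv (antipode k) * .toConv .id : WithConv (B →ₗ[k] B)).ofConv := by
          rw [LinearMap.algHom_comp_convMul_distrib]; rfl
      _ = (1 : WithConv (B →ₗ[k] A)).ofConv := by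
          rw [LinearMap.antipode_mul_id, LinearMap.algHom_comp_convOne]
  have h2 : φ * r = 1 := by
    apply WithConv.ofConv_injective
    calc (φ * r).ofConv = (.toConv .id * .toConv (antipode k) : WithConv (A →ₗ[k] A)).ofConv ∘ₗ
          (f : B →ₗc[k] A).toLinearMap := by
          rw [LinearMap.convMul_comp_coalgHom_distrib]; rfl
      _ = (1 : WithConv (B →ₗ[k] A)).ofConv := by
          rw [LinearMap.id_mul_antipode, LinearMap.convOne_comp_coalgHom]
  have h3 : l = r := left_inv_eq_right_inv h1 h2
  exact congr($(h3).ofConv b)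

end Antipode

section Pushout

variable {k : Type u} {B A K : Type*} [Field k] [Ring B] [HopfAlgebra k B] [Ring A]
  [HopfAlgebra k A] [Ring K] [HopfAlgebra k K]

/-- The ideal `(𝒥)` of `A` generated by (the image in `A` of) `𝒥 = ker p`. -/
def pushoutIdeal (ι : B →ₐc[k] A) (p : B →ₐc[k] K) : Ideal A :=
  (TwoSidedIdeal.span (ι '' {b : B | p b = 0})).asIdeal

instance (ι : B →ₐc[k] A) (p : B →ₐc[k] K) : (pushoutIdeal ι p).IsTwoSided :=
  inferInstanceAs (TwoSidedIdeal.asIdeal _).IsTwoSided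

theorem map_mem_pushoutIdeal (ι : B →ₐc[k] A) (p : B →ₐc[k] K) {b : B} (hb : p b = 0) :
    ι b ∈ pushoutIdeal ι p :=
  TwoSidedIdeal.mem_asIdeal.2 (TwoSidedIdeal.subset_span ⟨b, hb, rfl⟩)

theorem pushoutIdeal_le_ker (ι : B →ₐc[k] A) (p : B →ₐc[k] K) {R : Type*} [Ring R] (f : A →+* R)
    (h : ∀ b, p b = 0 → f (ι b) = 0) {a : A} (ha : a ∈ pushoutIdeal ι p) : f a = 0 := by
  have hle : TwoSidedIdeal.span (ι '' {b : B | p b = 0}) ≤ TwoSidedIdeal.ker f := by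
    rw [TwoSidedIdeal.span_le]
    rintro _ ⟨b, hb, rfl⟩
    exact (TwoSidedIdeal.mem_ker f).2 (h b hb)
  exact (TwoSidedIdeal.mem_ker f).1 (hle (TwoSidedIdeal.mem_asIdeal.1 ha))

/-- If `ι(B)` is central, then `(𝒥) = A𝒥`. -/
theorem pushoutIdeal_eq_span (ι : B →ₐc[k] A) (p : B →ₐc[k] K) (hι : IsCentralMap ι) :
    pushoutIdeal ι p = Ideal.span (ι '' {b : B | p b = 0}) := by
  have h2 : (Ideal.span (ι '' {b : B | p b = 0})).IsTwoSided := by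
    refine ⟨fun {a} c ha => ?_⟩
    induction ha using Submodule.span_induction with
    | mem x hx =>
      obtain ⟨b, hb, rfl⟩ := hx
      rw [hι]
      exact Ideal.mul_mem_left _ _ (Ideal.subset_span ⟨b, hb, rfl⟩)
    | zero => simp
    | add x y _ _ hx hy => rw [add_mul]; exact add_mem hx hy
    | smul r x _ hx => rw [smul_eq_mul, mul_assoc]; exact Ideal.mul_mem_left _ _ hx
  apply le_antisymm
  · intro a ha
    have := pushoutIdeal_le_ker ι p (Ideal.Quotient.mk (Ideal.span (ι '' {b : B | p b = 0})))
      (fun b hb => Ideal.Quotient.eq_zero_iff_mem.2 (Ideal.subset_span ⟨b, hb, rfl⟩)) ha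
    exact Ideal.Quotient.eq_zero_iff_mem.1 this
  · rw [Ideal.span_le]
    rintro _ ⟨b, hb, rfl⟩
    exact map_mem_pushoutIdeal ι p hb

/-- A linear map that kills `ker p` factors through `p`. -/
theorem exists_factor {V W U : Type*} [AddCommGroup V] [Module k V] [AddCommGroup W] [Module k W]
    [AddCommGroup U] [Module k U] (p : V →ₗ[k] W) (f : V →ₗ[k] U) (h : ∀ v, p v = 0 → f v = 0) :
    ∃ g : W →ₗ[k] U, g ∘ₗ p = f := by
  obtain ⟨g, hg⟩ := LinearMap.exists_extend
    ((LinearMap.ker p).liftQ f (fun v hv => h v hv) ∘ₗ p.quotKerEquivRange.symm.toLinearMap)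
  refine ⟨g, LinearMap.ext fun v => ?_⟩
  have h1 := LinearMap.congr_fun hg ⟨p v, v, rfl⟩
  have h2 : p.quotKerEquivRange.symm ⟨p v, v, rfl⟩ = (LinearMap.ker p).mkQ v :=
    p.quotKerEquivRange_symm_apply_image v _
  rw [LinearMap.comp_apply]
  refine h1.trans ?_
  rw [LinearMap.comp_apply, LinearEquiv.coe_coe, h2]
  rfl

instance (ι : B →ₐc[k] A) (p : B →ₐc[k] K) : (pushoutIdeal ι p).IsHopfIdeal k where
  counit_eq_zero x hx := by
    refine pushoutIdeal_le_ker ι p (Bialgebra.counitAlgHom k A).toRingHom (fun b hb => ?_) hx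
    have h : counit (R := k) (p b) = counit (R := k) b := CoalgHomClass.counit_comp_apply p b
    have h' : counit (R := k) (ι b) = counit (R := k) b := CoalgHomClass.counit_comp_apply ι b
    change counit (R := k) (ι b) = 0
    rw [h', ← h, hb, map_zero]
  map_mkQ_comul_eq_zero x hx := by
    let q : A →ₐ[k] A ⧸ pushoutIdeal ι p := Ideal.Quotient.mkₐ k _
    refine pushoutIdeal_le_ker ι p
      ((Algebra.TensorProduct.map q q).comp (Bialgebra.comulAlgHom k A)).toRingHom
      (fun b hb => ?_) hx
    change TensorProduct.map q.toLinearMap q.toLinearMap (comul (R := k) (ι b)) = 0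
    obtain ⟨g, hg⟩ := exists_factor (p : B →ₗ[k] K) (q.toLinearMap ∘ₗ (ι : B →ₗ[k] A))
      (fun b hb => Ideal.Quotient.eq_zero_iff_mem.2 (map_mem_pushoutIdeal ι p hb))
    have h1 : comul (R := k) (ι b) = TensorProduct.map (ι : B →ₗ[k] A) (ι : B →ₗ[k] A)
      (comul (R := k) b) := (CoalgHomClass.map_comp_comul_apply ι b).symm
    have h2 : comul (R := k) (p b) = TensorProduct.map (p : B →ₗ[k] K) (p : B →ₗ[k] K)
      (comul (R := k) b) := (CoalgHomClass.map_comp_comul_apply p b).symm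
    rw [h1, ← LinearMap.comp_apply, ← TensorProduct.map_comp, ← hg, TensorProduct.map_comp,
      LinearMap.comp_apply, ← h2, hb, map_zero, map_zero]
  antipode_mem x hx := by
    have h := pushoutIdeal_le_ker ι p (((Ideal.Quotient.mkₐ k (pushoutIdeal ι p)).op.comp
      (antipodeAlgHomOp k A)).toRingHom) (fun b hb => ?_) hx
    · exact Ideal.Quotient.eq_zero_iff_mem.1 (MulOpposite.op_injective h)
    · change MulOpposite.op (Ideal.Quotient.mk (pushoutIdeal ι p) (antipode k (ι b))) = 0
      rw [← antipode_map, Ideal.Quotient.eq_zero_iff_mem.2, MulOpposite.op_zero]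
      apply map_mem_pushoutIdeal
      rw [antipode_map, hb, map_zero]

/-- The pushout `A_p = A / (𝒥)`, a quotient Hopf algebra of `A`. -/
abbrev Pushout (ι : B →ₐc[k] A) (p : B →ₐc[k] K) : Type _ := A ⧸ pushoutIdeal ι p

/-- The projection `q : A → A_p`. -/
noncomputable def Pushout.q (ι : B →ₐc[k] A) (p : B →ₐc[k] K) : A →ₐc[k] Pushout ι p :=
  Bialgebra.Quotient.mkBialgHom (pushoutIdeal ι p)

theorem Pushout.q_map_eq_zero (ι : B →ₐc[k] A) (p : B →ₐc[k] K) {b : B} (hb : p b = 0) :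
    Pushout.q ι p (ι b) = 0 :=
  Ideal.Quotient.eq_zero_iff_mem.2 (map_mem_pushoutIdeal ι p hb)

/-- The map `j : K → A_p` underlying `Pushout.j`. -/
noncomputable def Pushout.jAlg (ι : B →ₐc[k] A) (p : B →ₐc[k] K) (hp : Function.Surjective p) :
    K →ₐ[k] Pushout ι p :=
  (Ideal.Quotient.liftₐ (RingHom.ker (p : B →ₐ[k] K))
    ((Pushout.q ι p : A →ₐ[k] Pushout ι p).comp (ι : B →ₐ[k] A))
    (fun _ hb => Pushout.q_map_eq_zero ι p hb)).comp
  (Ideal.quotientKerAlgEquivOfSurjective (f := (p : B →ₐ[k] K)) hp).symm.toAlgHom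

theorem Pushout.jAlg_apply (ι : B →ₐc[k] A) (p : B →ₐc[k] K) (hp : Function.Surjective p) (b : B) :
    Pushout.jAlg ι p hp (p b) = Pushout.q ι p (ι b) := by
  have h := Ideal.quotientKerAlgEquivOfSurjective_symm_apply (f := (p : B →ₐ[k] K)) hp b
  exact congrArg (Ideal.Quotient.liftₐ (RingHom.ker (p : B →ₐ[k] K))
    ((Pushout.q ι p : A →ₐ[k] Pushout ι p).comp (ι : B →ₐ[k] A))
    (fun _ hb => Pushout.q_map_eq_zero ι p hb)) h

/-- The Hopf algebra map `j : K → A_p` with `j p = q ι`. -/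
noncomputable def Pushout.j (ι : B →ₐc[k] A) (p : B →ₐc[k] K) (hp : Function.Surjective p) :
    K →ₐc[k] Pushout ι p :=
  .ofAlgHom (Pushout.jAlg ι p hp)
    (by
      refine AlgHom.ext fun x => ?_
      obtain ⟨b, rfl⟩ := hp x
      change counit (R := k) (Pushout.jAlg ι p hp (p b)) = counit (R := k) (p b)
      rw [Pushout.jAlg_apply, CoalgHomClass.counit_comp_apply, CoalgHomClass.counit_comp_apply,
        CoalgHomClass.counit_comp_apply])
    (by
      refine AlgHom.ext fun x => ?_
      obtain ⟨b, rfl⟩ := hp x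
      change TensorProduct.map (Pushout.jAlg ι p hp).toLinearMap (Pushout.jAlg ι p hp).toLinearMap
        (comul (R := k) (p b)) = comul (R := k) (Pushout.jAlg ι p hp (p b))
      have hc : (Pushout.jAlg ι p hp).toLinearMap ∘ₗ (p : B →ₗ[k] K) =
          (Pushout.q ι p : A →ₗ[k] Pushout ι p) ∘ₗ (ι : B →ₗ[k] A) :=
        LinearMap.ext fun b => Pushout.jAlg_apply ι p hp b
      rw [Pushout.jAlg_apply, ← CoalgHomClass.map_comp_comul_apply,
        ← CoalgHomClass.map_comp_comul_apply, ← CoalgHomClass.map_comp_comul_apply]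
      have hm := congr(TensorProduct.map $hc $hc (comul (R := k) b))
      rwa [TensorProduct.map_comp, TensorProduct.map_comp] at hm)

theorem Pushout.j_apply (ι : B →ₐc[k] A) (p : B →ₐc[k] K) (hp : Function.Surjective p) (b : B) :
    Pushout.j ι p hp (p b) = Pushout.q ι p (ι b) :=
  Pushout.jAlg_apply ι p hp b

end Pushout

section Compatibility

/-- The iterated comultiplication `a ↦ a₍₁₎ ⊗ a₍₂₎ ⊗ a₍₃₎ ⊗ a₍₄₎`. -/
noncomputable def comul₄ (k : Type u) (A : Type v) [CommSemiring k] [AddCommMonoid A] [Module k A]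
    [Coalgebra k A] : A →ₗ[k] A ⊗[k] (A ⊗[k] (A ⊗[k] A)) :=
  LinearMap.lTensor A (LinearMap.lTensor A comul ∘ₗ comul) ∘ₗ comul

variable {k : Type u} {B A K₁ K₂ : Type*} [Field k] [Ring B] [HopfAlgebra k B] [Ring A]
  [HopfAlgebra k A] [Ring K₁] [HopfAlgebra k K₁] [Ring K₂] [HopfAlgebra k K₂]

/-- The linear map `b ⊗ b' ↦ p₂(g(b)) u(ι(b'))`. -/
noncomputable def compatMap₁ (ι : B →ₐc[k] A) (p₂ : B →ₐc[k] K₂) (g : B ≃ₐc[k] B)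
    (u : A →ₐ[k] K₂) : B ⊗[k] B →ₗ[k] K₂ :=
  LinearMap.mul' k K₂ ∘ₗ TensorProduct.map
    ((p₂ : B →ₗ[k] K₂) ∘ₗ (g : B →ₗ[k] B)) (u.toLinearMap ∘ₗ (ι : B →ₗ[k] A))

theorem compatMap₁_tmul (ι : B →ₐc[k] A) (p₂ : B →ₐc[k] K₂) (g : B ≃ₐc[k] B)
    (u : A →ₐ[k] K₂) (b b' : B) :
    compatMap₁ ι p₂ g u (b ⊗ₜ b') = p₂ (g b) * u (ι b') := rfl

/-- The linear map `x ⊗ y ⊗ z ⊗ w ↦ u(y) ⊗ q(F(S(x) z)) u(w)`. -/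
noncomputable def compatMap₂ {C : Type*} [Ring C] [Algebra k C] (q : A →ₐ[k] C)
    (F : A ≃ₐc[k] A) (u : A →ₐ[k] C) : A ⊗[k] (A ⊗[k] (A ⊗[k] A)) →ₗ[k] C ⊗[k] C :=
  TensorProduct.map u.toLinearMap
    (LinearMap.mul' k C ∘ₗ
      TensorProduct.map
        (q.toLinearMap ∘ₗ (F : A →ₗ[k] A) ∘ₗ LinearMap.mul' k A ∘ₗ
          LinearMap.rTensor A (antipode k))
        u.toLinearMap ∘ₗ
      (TensorProduct.assoc k A A A).symm.toLinearMap) ∘ₗ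
  (TensorProduct.leftComm k A A (A ⊗[k] A)).toLinearMap

theorem compatMap₂_tmul {C : Type*} [Ring C] [Algebra k C] (q : A →ₐ[k] C)
    (F : A ≃ₐc[k] A) (u : A →ₐ[k] C) (x y z w : A) :
    compatMap₂ q F u (x ⊗ₜ (y ⊗ₜ (z ⊗ₜ w))) =
      u y ⊗ₜ (q (F (antipode k x * z)) * u w) := rfl

/-- `ω(p₁(b)) = p₂(g(b₍₁₎)) u(ι(b₍₂₎))` for all `b ∈ B`. -/
def Compat₁ (ι : B →ₐc[k] A) (p₁ : B →ₐc[k] K₁) (p₂ : B →ₐc[k] K₂) (ω : K₁ ≃ₐc[k] K₂)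
    (g : B ≃ₐc[k] B) (u : A →ₐ[k] K₂) : Prop :=
  ∀ b : B, ω (p₁ b) = compatMap₁ ι p₂ g u (comul (R := k) b)

/-- `Δ(u(a)) = u(a₍₂₎) ⊗ q₂(F(S(a₍₁₎) a₍₃₎)) u(a₍₄₎)` for all `a ∈ A`; the identity is read in
`A₂ ⊗ A₂`, where `A₂` is the pushout along `p₂` and `K₂` is mapped to `A₂` by `j₂`. -/
def Compat₂ (ι : B →ₐc[k] A) (p₂ : B →ₐc[k] K₂) (hp₂ : Function.Surjective p₂)
    (F : A ≃ₐc[k] A) (u : A →ₐ[k] K₂) : Prop :=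
  ∀ a : A,
    TensorProduct.map (Pushout.j ι p₂ hp₂ : K₂ →ₗ[k] Pushout ι p₂)
        (Pushout.j ι p₂ hp₂ : K₂ →ₗ[k] Pushout ι p₂) (comul (R := k) (u a)) =
      compatMap₂ (Pushout.q ι p₂ : A →ₐ[k] Pushout ι p₂) F
        ((Pushout.j ι p₂ hp₂ : K₂ →ₐ[k] Pushout ι p₂).comp u) (comul₄ k A a)

end Compatibility

end HopfExt

/-! Write Aᵢ for the pushouts and `*` for convolution. If centrality makes Kᵢ central in Aᵢ, and
exactness survives so that Kᵢ is exactly the algebra of left coinvariants of Aᵢ → H, then an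
isomorphism e : A₁ → A₂ can be compared with automorphisms of A. By (Z) the image of K₁ in H under e
is a central Hopf subalgebra, hence trivial, so e carries K₁ into the coinvariants K₂. Symmetrically
for the inverse; this gives ω, and e also induces an automorphism f of H. By (L) f lifts to F, which
restricts to g on B. The maps q₂F and eq₁ agree modulo K₂, so their convolution quotient u = (q₂F)⁻¹
* eq₁ takes coinvariant, hence central, values in K₂; it is therefore an algebra map, and the two
identities of the triple are formal (`exists_compat_of_bialgEquiv`).

Conversely, q₂F * u is an algebra map because u has central values. The first identity makes it
descend to A₁, the second makes it comultiplicative, and the inverse comes from q₁ * (ω⁻¹u)S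
(`nonempty_bialgEquiv_of_compat`).

The substantial input is the survival of exactness: `Pushout.j_injective` and `Pushout.exists_j_eq`.
Faithful flatness of A over B is replaced by `exists_local_retraction`: for any finite subset of A
there is a k-linear retraction A → B that is B-linear on that subset. It is built in two stages.
Noetherianity, Nakayama at the augmentation ideal and the antipode give a map φ, B-linear on a
finite-dimensional left coideal, with ε(φ(1)) = 1 (`exists_semilinear_counit_eq_one`). An averaging
with the antipode then turns φ into one with φ(1) = 1. -/

namespace HopfExt

/-! ### Local finiteness: finite-dimensional left coideals. -/

section Coideal

variable {k : Type*} {C : Type*} [Field k] [AddCommGroup C] [Module k C] [Coalgebra k C]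

/-- `V` is a left coideal: `Δ(V) ⊆ C ⊗ V`. -/
def IsLeftCoideal (V : Submodule k C) : Prop :=
  ∀ v ∈ V, comul (R := k) v ∈ LinearMap.range (LinearMap.lTensor C V.subtype)

theorem IsLeftCoideal.exists_sum {V : Submodule k C} (hV : IsLeftCoideal V) {v : C} (hv : v ∈ V) :
    ∃ S : Finset (C × V), comul (R := k) v = ∑ i ∈ S, i.1 ⊗ₜ[k] (i.2 : C) := by
  obtain ⟨t, ht⟩ := hV v hv
  obtain ⟨S, rfl⟩ := TensorProduct.exists_finset t
  exact ⟨S, by rw [← ht, map_sum]; rfl⟩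

theorem IsLeftCoideal.sup {V W : Submodule k C} (hV : IsLeftCoideal V) (hW : IsLeftCoideal W) :
    IsLeftCoideal (V ⊔ W) := by
  have mono : ∀ {V₁ V₂ : Submodule k C}, V₁ ≤ V₂ →
      LinearMap.range (LinearMap.lTensor C V₁.subtype) ≤
        LinearMap.range (LinearMap.lTensor C V₂.subtype) := by
    intro V₁ V₂ h
    rw [← Submodule.subtype_comp_inclusion V₁ V₂ h, LinearMap.lTensor_comp]
    exact LinearMap.range_comp_le_range _ _
  intro x hx
  obtain ⟨v, hv, w, hw, rfl⟩ := Submodule.mem_sup.1 hx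
  rw [map_add]
  exact add_mem (mono le_sup_left (hV v hv)) (mono le_sup_right (hW w hw))

/-- Expand Δ(x) = Σ bⱼ ⊗ yⱼ in a basis. The span of the finitely many yⱼ contains x by the counit
axiom, and it is a left coideal by coassociativity, since each yᵢ is obtained from Δ(x) by applying
a coordinate functional on the left. -/
theorem exists_isLeftCoideal_mem (x : C) :
    ∃ V : Submodule k C, V.FG ∧ x ∈ V ∧ IsLeftCoideal V := by
  classical
  let b := Module.Basis.ofVectorSpace k C
  let e := TensorProduct.equivFinsuppOfBasisLeft (N := C) b
  let y := e (comul (R := k) x)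
  have hsum : comul (R := k) x = ∑ j ∈ y.support, b j ⊗ₜ[k] y j := by
    have h := (e.symm_apply_apply (comul (R := k) x)).symm
    rwa [TensorProduct.equivFinsuppOfBasisLeft_symm_apply] at h
  let L : (C →ₗ[k] k) → C ⊗[k] C →ₗ[k] C := fun l =>
    (TensorProduct.lid k C).toLinearMap ∘ₗ LinearMap.rTensor C l
  have hy : ∀ i, y i = L (b.coord i) (comul (R := k) x) := by
    intro i
    exact TensorProduct.equivFinsuppOfBasisLeft_apply b _ i
  have hmem : ∀ j, y j ∈ Submodule.span k (y '' y.support) := by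
    intro j
    by_cases hj : j ∈ y.support
    · exact Submodule.subset_span ⟨j, hj, rfl⟩
    · rw [Finsupp.notMem_support_iff.1 hj]; exact zero_mem _
  refine ⟨Submodule.span k (y '' y.support), Submodule.fg_span (y.support.finite_toSet.image _),
    ?_, ?_⟩
  · have h2 : x = L counit (comul (R := k) x) := by simp [L]
    rw [h2, hsum, map_sum]
    refine sum_mem fun j _ => ?_
    simp only [L, LinearMap.comp_apply, LinearMap.rTensor_tmul, LinearEquiv.coe_coe,
      TensorProduct.lid_tmul]
    exact Submodule.smul_mem _ _ (hmem j)
  · intro v hv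
    induction hv using Submodule.span_induction with
    | zero => simp
    | add p q _ _ hp hq => rw [map_add]; exact add_mem hp hq
    | smul r p _ hp => rw [map_smul]; exact Submodule.smul_mem _ _ hp
    | mem v hv =>
      obtain ⟨i, -, rfl⟩ := hv
      have h1 : comul (R := k) ∘ₗ L (b.coord i) = (TensorProduct.lid k (C ⊗[k] C)).toLinearMap ∘ₗ
          LinearMap.rTensor (C ⊗[k] C) (b.coord i) ∘ₗ LinearMap.lTensor C comul := by
        ext p q; simp [L]
      have h2 : ∀ (t : C ⊗[k] C) (z : C), TensorProduct.lid k (C ⊗[k] C)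
          (LinearMap.rTensor (C ⊗[k] C) (b.coord i) (TensorProduct.assoc k C C C (t ⊗ₜ z))) =
          L (b.coord i) t ⊗ₜ z := by
        intro t z
        induction t with
        | zero => simp
        | add p q hp hq => simp only [TensorProduct.add_tmul, map_add, hp, hq]
        | tmul p q => simp [L, TensorProduct.smul_tmul']
      rw [hy, ← LinearMap.comp_apply, h1]
      simp only [LinearMap.comp_apply, LinearEquiv.coe_coe]
      rw [← Coalgebra.coassoc_apply, hsum]
      simp only [map_sum, LinearMap.rTensor_tmul, h2]
      refine sum_mem fun j _ => ⟨_ ⊗ₜ ⟨y j, hmem j⟩, rfl⟩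

theorem exists_isLeftCoideal_ge (s : Finset C) :
    ∃ V : Submodule k C, V.FG ∧ (∀ x ∈ s, x ∈ V) ∧ IsLeftCoideal V := by
  classical
  induction s using Finset.induction_on with
  | empty => exact ⟨⊥, Submodule.fg_bot, by simp, fun v hv => by simp_all⟩
  | insert a s _ ih =>
    obtain ⟨V, h1, h2, h3⟩ := ih
    obtain ⟨W, h1', h2', h3'⟩ := exists_isLeftCoideal_mem (k := k) a
    refine ⟨W ⊔ V, h1'.sup h1, fun x hx => ?_, h3'.sup h3⟩
    rcases Finset.mem_insert.1 hx with rfl | hx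
    · exact Submodule.mem_sup_left h2'
    · exact Submodule.mem_sup_right (h2 x hx)

end Coideal

/-! ### Linear algebra: a Fitting argument, coordinates and Nakayama. -/

section Algebra

/-- By noetherianity ker fⁿ and im fⁿ are disjoint for large n. Since f and σ commute, σⁿ maps into
im fⁿ and preserves ker f, so it must kill ker f. With σ = 1 this is the injectivity of surjective
endomorphisms. -/
theorem exists_pow_apply_eq_zero {A N : Type*} [Ring A] [AddCommGroup N] [Module A N]
    [IsNoetherian A N] (f σ : Module.End A N) (hc : Commute f σ)
    (hr : LinearMap.range σ ≤ LinearMap.range f) : ∃ n : ℕ, ∀ x, f x = 0 → (σ ^ n) x = 0 := by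
  have hpow : ∀ n x, ∃ y, (σ ^ n) x = (f ^ n) y := by
    intro n
    induction n with
    | zero => exact fun x => ⟨x, rfl⟩
    | succ n ih =>
      intro x
      obtain ⟨y, hy⟩ := ih x
      obtain ⟨z, hz⟩ := hr ⟨y, rfl⟩
      refine ⟨z, ?_⟩
      rw [pow_succ', Module.End.mul_apply, hy, ← Module.End.mul_apply,
        ← (hc.pow_left n).eq, Module.End.mul_apply, ← hz, pow_succ, Module.End.mul_apply]
  obtain ⟨n, hn⟩ := Filter.eventually_atTop.1 (Module.End.eventually_disjoint_ker_pow_range_pow f)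
  -- The exponent must be positive, so that f x = 0 forces x into the kernel of that power of f.
  refine ⟨n + 1, fun x hx => ?_⟩
  obtain ⟨y, hy⟩ := hpow (n + 1) x
  refine Submodule.disjoint_def.1 (hn (n + 1) (Nat.le_succ n)) _ ?_ ⟨y, hy.symm⟩
  rw [LinearMap.mem_ker, ← Module.End.mul_apply, ((hc.pow_pow _ _).eq), Module.End.mul_apply,
    pow_succ f n, Module.End.mul_apply, hx, map_zero, map_zero]

/-- Coordinates on a finite-dimensional subspace `V` modulo a subspace `E`. -/
theorem exists_coordinates_mod {k A : Type*} [Field k] [AddCommGroup A] [Module k A]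
    (V E : Submodule k A) (hV : V.FG) :
    ∃ (n : ℕ) (v : Fin n → A) (c : Fin n → A →ₗ[k] k), (∀ j, v j ∈ V) ∧
      (∀ i j, c i (v j) = if i = j then 1 else 0) ∧ (∀ i, ∀ x ∈ E, c i x = 0) ∧
      ∀ x ∈ V, x - ∑ i, c i x • v i ∈ E := by
  let Q := V.map E.mkQ
  have : FiniteDimensional k Q := Module.Finite.iff_fg.2 (hV.map _)
  let β := Module.finBasis k Q
  have hlift : ∀ j, ∃ v ∈ V, E.mkQ v = β j := fun j => (β j).2
  choose v hv hvβ using hlift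
  have hext : ∀ i, ∃ g : A ⧸ E →ₗ[k] k, g ∘ₗ Q.subtype = β.coord i :=
    fun i => LinearMap.exists_extend _
  choose g hg using hext
  have hgQ : ∀ i (q : Q), g i q = β.repr q i := fun i q => LinearMap.congr_fun (hg i) q
  refine ⟨_, v, fun i => g i ∘ₗ E.mkQ, hv, fun i j => ?_, fun i x hx => ?_, fun x hx => ?_⟩
  · rw [LinearMap.comp_apply, hvβ, hgQ, Module.Basis.repr_self, Finsupp.single_apply]
    simp only [eq_comm]
  · rw [LinearMap.comp_apply, Submodule.mkQ_apply, (Submodule.Quotient.mk_eq_zero E).2 hx, map_zero]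
  · rw [← Submodule.Quotient.mk_eq_zero, ← Submodule.mkQ_apply, map_sub, map_sum, sub_eq_zero]
    let q : Q := ⟨E.mkQ x, x, hx, rfl⟩
    have h := congrArg (Subtype.val) (β.sum_repr q)
    refine (Eq.trans ?_ h).symm
    rw [AddSubmonoidClass.coe_finsetSum]
    refine Finset.sum_congr rfl fun i _ => ?_
    rw [map_smul, hvβ, LinearMap.comp_apply, ← hgQ]
    rfl

/-- A form of Nakayama's lemma for a map from a commutative ring. -/
theorem exists_sub_one_mem_mul_eq_sum {k B A : Type*} [Field k] [CommRing B] [Algebra k B] [Ring A]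
    [Algebra k A] (ι : B →ₐ[k] A) (I : Ideal B) (V : Submodule k A) (hV : V.FG) {n : ℕ}
    (v : Fin n → A) (h : ∀ x ∈ V, ∃ t : Fin n → B, x - ∑ j, ι (t j) * v j ∈
      Submodule.span k {y | ∃ b ∈ I, ∃ x ∈ V, y = ι b * x}) :
    ∃ r : B, r - 1 ∈ I ∧ ∀ x ∈ V, ∃ t : Fin n → B, ι r * x = ∑ j, ι (t j) * v j := by
  let : Module B A := Module.compHom A (ι : B →+* A)
  have hsm : ∀ (b : B) (a : A), b • a = ι b * a := fun _ _ => rfl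
  have hsk : ∀ (r : k) (a : A), r • a = algebraMap k B r • a := fun r a => by
    rw [hsm, AlgHom.commutes, Algebra.smul_def]
  let M : Submodule B A := Submodule.span B (V : Set A)
  let N : Submodule B A := Submodule.span B (Set.range v)
  have hM : M.FG := by
    obtain ⟨s, hs⟩ := hV
    refine ⟨s, le_antisymm (Submodule.span_mono ?_) (Submodule.span_le.2 fun x hx => ?_)⟩
    · rw [← hs]; exact Submodule.subset_span
    · rw [← hs] at hx
      induction hx using Submodule.span_induction with
      | mem y hy => exact Submodule.subset_span hy
      | zero => exact zero_mem _
      | add _ _ _ _ h1 h2 => exact add_mem h1 h2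
      | smul r y _ hy => rw [hsk]; exact Submodule.smul_mem _ _ hy
  have hE : ∀ y ∈ Submodule.span k {y | ∃ b ∈ I, ∃ x ∈ V, y = ι b * x}, y ∈ I • M := by
    intro y hy
    induction hy using Submodule.span_induction with
    | mem y hy =>
      obtain ⟨b, hb, x, hx, rfl⟩ := hy
      exact Submodule.smul_mem_smul hb (Submodule.subset_span hx)
    | zero => exact zero_mem _
    | add _ _ _ _ h1 h2 => exact add_mem h1 h2
    | smul r y _ hy => rw [hsk]; exact Submodule.smul_mem _ _ hy
  -- The hypothesis says that the vⱼ generate M = B·V modulo I·M, which is the input of Nakayama.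
  have hle : M ≤ N ⊔ I • M := by
    refine Submodule.span_le.2 fun x hx => ?_
    obtain ⟨t, ht⟩ := h x hx
    refine Submodule.mem_sup.2 ⟨∑ j, ι (t j) * v j, ?_, _, hE _ ht, by abel⟩
    exact sum_mem fun j _ => Submodule.smul_mem N (t j) (Submodule.subset_span ⟨j, rfl⟩)
  obtain ⟨r, hr, hrM⟩ := Submodule.exists_sub_one_mem_and_smul_le_of_fg_of_le_sup
    (N := N) (N' := M) (P := M) hM le_rfl hle
  refine ⟨r, hr, fun x hx => ?_⟩
  have hx' : r • x ∈ N := hrM (Submodule.smul_mem_pointwise_smul _ _ _ (Submodule.subset_span hx))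
  obtain ⟨t, ht⟩ := (Submodule.mem_span_range_iff_exists_fun B).1 hx'
  exact ⟨t, by rw [← hsm, ← ht]; rfl⟩

end Algebra

/-! ### Local retractions of a central Hopf subalgebra. -/

section Retraction

open WithConv

variable {k B A : Type*} [Field k] [Ring B] [HopfAlgebra k B] [Ring A] [HopfAlgebra k A]

theorem IsCentralMap.mul_comm {ι : B →ₐc[k] A} (hι : IsCentralMap ι) (hinj : Function.Injective ι)
    (b b' : B) : b * b' = b' * b := hinj (by rw [map_mul, map_mul, hι])

theorem exists_counit_eq_one_mul_eq_sum (ι : B →ₐc[k] A) (hcomm : ∀ b b' : B, b * b' = b' * b)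
    (V : Submodule k A) (hV : V.FG) {n : ℕ}
    (v : Fin n → A) (h : ∀ x ∈ V, ∃ t : Fin n → B, x - ∑ j, ι (t j) * v j ∈
      Submodule.span k {y | ∃ b : B, counit (R := k) b = 0 ∧ ∃ x ∈ V, y = ι b * x}) :
    ∃ r : B, counit (R := k) r = 1 ∧
      ∀ x ∈ V, ∃ t : Fin n → B, ι r * x = ∑ j, ι (t j) * v j := by
  -- Nakayama is applied with the augmentation ideal of B, so r - 1 ∈ I becomes ε(r) = 1.
  let : CommRing B := { ‹Ring B› with mul_comm := hcomm }
  obtain ⟨r, hr, hr'⟩ := exists_sub_one_mem_mul_eq_sum (ι : B →ₐ[k] A)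
    (RingHom.ker (Bialgebra.counitAlgHom k B)) V hV v h
  refine ⟨r, ?_, hr'⟩
  rw [RingHom.mem_ker, map_sub, map_one, sub_eq_zero] at hr
  exact hr

theorem comul_map_eq_sum (ι : B →ₐc[k] A) {b : B} {α : Type*} (R : Coalgebra.Repr k b α) :
    comul (R := k) (ι b) = ∑ i ∈ R.index, ι (R.left i) ⊗ₜ[k] ι (R.right i) := by
  rw [← CoalgHomClass.map_comp_comul_apply, ← R.eq, map_sum]
  rfl

/-- The map `x ↦ x₍₁₎ c(x₍₂₎)`. -/
noncomputable def hit (c : A →ₗ[k] k) : A →ₗ[k] A :=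
  (toConv LinearMap.id * toConv (Algebra.linearMap k A ∘ₗ c)).ofConv

theorem hit_of_sum (c : A →ₗ[k] k) {x : A} {α : Type*} {S : Finset α} {l r : α → A}
    (h : comul (R := k) x = ∑ p ∈ S, l p ⊗ₜ[k] r p) : hit c x = ∑ p ∈ S, c (r p) • l p := by
  change LinearMap.mul' k A (TensorProduct.map _ _ (comul (R := k) x)) = _
  rw [h, map_sum, map_sum]
  refine Finset.sum_congr rfl fun p _ => ?_
  simp [Algebra.smul_def, Algebra.commutes]

/-- In the convolution algebra `hit c` is id * c, and S * id = 1. Thus the antipode recovers the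
scalar c(x) from the values of `hit c`. -/
theorem sum_antipode_mul_hit (c : A →ₗ[k] k) {x : A} {α : Type*} {S : Finset α} {l r : α → A}
    (h : comul (R := k) x = ∑ p ∈ S, l p ⊗ₜ[k] r p) :
    ∑ p ∈ S, antipode k (l p) * hit c (r p) = algebraMap k A (c x) := by
  have h1 : toConv (antipode k) * toConv (hit c) = toConv (Algebra.linearMap k A ∘ₗ c) := by
    change toConv (antipode k) * (toConv LinearMap.id * toConv (Algebra.linearMap k A ∘ₗ c)) = _
    rw [← mul_assoc, LinearMap.antipode_mul_id, one_mul]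
  have h2 := congr($(h1).ofConv x)
  change LinearMap.mul' k A (TensorProduct.map _ _ (comul (R := k) x)) = _ at h2
  rw [h, map_sum, map_sum] at h2
  exact h2

/-- As V is a left coideal, the second legs of Δ(x) stay in V, where c turns b₍₂₎ into ε(b₍₂₎); the
counit axiom reassembles b. So a functional on V modulo B⁺V becomes a B-linear map to A. -/
theorem hit_mul (ι : B →ₐc[k] A) (c : A →ₗ[k] k) {V : Submodule k A} (hV : IsLeftCoideal V)
    (hc : ∀ b, ∀ x ∈ V, c (ι b * x) = counit (R := k) b * c x) (b : B) {x : A} (hx : x ∈ V) :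
    hit c (ι b * x) = ι b * hit c x := by
  obtain ⟨S, hS⟩ := hV.exists_sum hx
  let R := ℛ k b
  have hb := comul_map_eq_sum ι R
  have hbx : comul (R := k) (ι b * x) = ∑ p ∈ R.index ×ˢ S,
      (ι (R.left p.1) * p.2.1) ⊗ₜ[k] (ι (R.right p.1) * (p.2.2 : A)) := by
    rw [Bialgebra.comul_mul, hb, hS, Finset.sum_mul_sum, Finset.sum_product]
    simp only [Algebra.TensorProduct.tmul_mul_tmul]
  have hb' : ∑ i ∈ R.index, counit (R := k) (R.right i) • R.left i = b := by
    have h := congr(TensorProduct.rid k B $(Coalgebra.sum_tmul_counit_eq R))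
    simpa only [map_sum, TensorProduct.rid_tmul, one_smul] using h
  rw [hit_of_sum c hS, hit_of_sum c hbx, Finset.sum_product]
  conv_rhs => rw [← hb']
  simp only [map_sum, Finset.sum_mul_sum, map_smul]
  refine Finset.sum_congr rfl fun i _ => Finset.sum_congr rfl fun p _ => ?_
  rw [hc _ _ p.2.2, smul_mul_smul_comm]

/-- Lift a basis of V modulo B⁺V to v₁, …, vₙ. After multiplication by some s ∈ B with ε(s) = 1 they
generate V over B, and a power of s kills all B-relations between them. So BV behaves like a free
module once s is allowed as a denominator, and ε restricted to the vⱼ extends to a B-linear map on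
V. -/
theorem exists_semilinear_counit_eq_one (ι : B →ₐc[k] A) (hinj : Function.Injective ι)
    (hι : IsCentralMap ι) (hnoeth : IsNoetherianRing A) (V : Submodule k A) (hfg : V.FG)
    (hV : IsLeftCoideal V) (h1 : 1 ∈ V) :
    ∃ φ : A →ₗ[k] B, (∀ b, ∀ x ∈ V, φ (ι b * x) = b * φ x) ∧ counit (R := k) (φ 1) = 1 := by
  have hcomm := hι.mul_comm hinj
  let E : Submodule k A :=
    Submodule.span k {y | ∃ b : B, counit (R := k) b = 0 ∧ ∃ x ∈ V, y = ι b * x}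
  have hιε : ∀ b, counit (R := k) (ι b) = counit (R := k) b := CoalgHomClass.counit_comp_apply ι
  have hιr : ∀ r : k, ι (algebraMap k B r) = algebraMap k A r := fun r =>
    AlgHomClass.commutes ι r
  obtain ⟨n, v, c, hvV, hcv, hcE, hxE⟩ := exists_coordinates_mod V E hfg
  have hc : ∀ i b, ∀ x ∈ V, c i (ι b * x) = counit (R := k) b * c i x := by
    intro i b x hx
    have hmem : ι (b - algebraMap k B (counit (R := k) b)) * x ∈ E :=
      Submodule.subset_span ⟨_, by simp, x, hx, rfl⟩
    have h := hcE i _ hmem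
    rwa [map_sub, sub_mul, map_sub, sub_eq_zero, hιr, ← Algebra.smul_def, map_smul,
      smul_eq_mul] at h
  obtain ⟨s, hs, hsV⟩ := exists_counit_eq_one_mul_eq_sum ι hcomm V hfg v (fun x hx => by
    refine ⟨fun j => algebraMap k B (c j x), ?_⟩
    simp only [hιr, ← Algebra.smul_def]
    exact hxE x hx)
  have hΨ : ∀ t : Fin n → B, ∀ i,
      hit (c i) (∑ j, ι (t j) * v j) = ∑ j, ι (t j) * hit (c i) (v j) := by
    intro t i
    rw [map_sum]
    exact Finset.sum_congr rfl fun j _ => hit_mul ι (c i) hV (hc i) _ (hvV j)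
  -- The matrix (`hit (c i) (v j)`) acting on Aⁿ. A B-relation Σ tⱼvⱼ = 0 gives a vector of its
  -- kernel, because the maps `hit (c i)` are B-linear on V.
  let f : Module.End A (Fin n → A) := Fintype.linearCombination A fun j i => hit (c i) (v j)
  have hf : ∀ a i, f a i = ∑ j, a j * hit (c i) (v j) := by
    intro a i
    simp [f, Fintype.linearCombination_apply]
  let σ : Module.End A (Fin n → A) :=
    { toFun := fun a i => ι s * a i
      map_add' := fun a b => by ext i; simp [mul_add]
      map_smul' := fun r a => by
        ext i
        simp only [Pi.smul_apply, smul_eq_mul, RingHom.id_apply, ← mul_assoc, hι s r] }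
  have hσ : ∀ a i, σ a i = ι s * a i := fun _ _ => rfl
  have hσpow : ∀ m a i, (σ ^ m) a i = ι (s ^ m) * a i := by
    intro m
    induction m with
    | zero => intro a i; simp
    | succ m ih =>
      intro a i
      rw [pow_succ', Module.End.mul_apply, hσ, ih, ← mul_assoc, ← map_mul, ← pow_succ']
  have hfσ : Commute f σ := by
    refine LinearMap.ext fun a => funext fun i => ?_
    rw [Module.End.mul_apply, Module.End.mul_apply, hf, hσ, hf, Finset.mul_sum]
    simp only [hσ, mul_assoc]
  have hrange : LinearMap.range σ ≤ LinearMap.range f := by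
    -- Since cₗ(vᵢ) = δₗᵢ, the i-th unit vector is Σ S(x₍₁₎) · hit(x₍₂₎) with x = vᵢ. Multiplying by
    -- s lets x₍₂₎ ∈ V be written through the vⱼ, which puts the sum in the range of f.
    have hbasis : ∀ i, σ (Pi.single i 1) ∈ LinearMap.range f := by
      intro i
      obtain ⟨S, hS⟩ := hV.exists_sum (hvV i)
      choose t ht using hsV
      have heq : σ (Pi.single i 1) =
          ∑ p ∈ S, antipode k p.1 • f fun j => ι (t p.2 p.2.2 j) := by
        ext l
        rw [hσ, Finset.sum_apply]
        have h := sum_antipode_mul_hit (c l) hS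
        rw [hcv] at h
        have h' : (Pi.single i (1 : A) : Fin n → A) l =
            algebraMap k A (if l = i then 1 else 0) := by
          rw [Pi.single_apply]; split_ifs <;> simp
        rw [h', ← h, Finset.mul_sum]
        refine Finset.sum_congr rfl fun p _ => ?_
        rw [Pi.smul_apply, hf, ← hΨ, ← ht, hit_mul ι (c l) hV (hc l) _ p.2.2, smul_eq_mul,
          ← mul_assoc, ← mul_assoc, hι]
      rw [heq]
      exact sum_mem fun p _ => Submodule.smul_mem _ _ ⟨_, rfl⟩
    rintro _ ⟨a, rfl⟩
    have ha : a = ∑ i, a i • (Pi.single i 1 : Fin n → A) := by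
      ext j; simp [Finset.sum_apply, Pi.single_apply]
    rw [ha, map_sum]
    exact sum_mem fun i _ => by rw [map_smul]; exact Submodule.smul_mem _ _ (hbasis i)
  obtain ⟨m, hm⟩ := exists_pow_apply_eq_zero f σ hfσ hrange
  let p : (Fin n → B) →ₗ[k] A :=
    ∑ j, LinearMap.mulRight k (v j) ∘ₗ (ι : B →ₗ[k] A) ∘ₗ LinearMap.proj j
  have hp : ∀ t, p t = ∑ j, ι (t j) * v j := fun t => by simp [p]
  let g : (Fin n → B) →ₗ[k] B :=
    ∑ j, counit (R := k) (v j) • LinearMap.mulLeft k (s ^ m) ∘ₗ LinearMap.proj j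
  have hg : ∀ t, g t = ∑ j, counit (R := k) (v j) • (s ^ m * t j) := fun t => by simp [g]
  -- The assignment Σ tⱼvⱼ ↦ Σ ε(vⱼ) sᵐtⱼ is well defined, because sᵐ annihilates the coefficients
  -- of every relation.
  obtain ⟨h, hh⟩ := exists_factor p g (fun t ht => by
    rw [hg]
    refine Finset.sum_eq_zero fun j _ => ?_
    have h0 : f (fun j => ι (t j)) = 0 := by
      ext i
      rw [hf, ← hΨ, ← hp, ht, map_zero, Pi.zero_apply]
    have h1 := congrFun (hm _ h0) j
    rw [hσpow, Pi.zero_apply, ← map_mul] at h1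
    rw [(map_eq_zero_iff ι hinj).1 h1, smul_zero])
  have hh' : ∀ t : Fin n → B, h (∑ j, ι (t j) * v j) = ∑ j, counit (R := k) (v j) • (s ^ m * t j) :=
    fun t => by rw [← hp, ← hg, ← hh]; rfl
  -- Multiplying by s first moves V into the B-span of the vⱼ, where h is known. The counit of the
  -- value at 1 is 1 because ε(s) = 1.
  refine ⟨h ∘ₗ LinearMap.mulLeft k (ι s), fun b x hx => ?_, ?_⟩
  · obtain ⟨t, ht⟩ := hsV x hx
    have ht' : ι s * (ι b * x) = ∑ j, ι (b * t j) * v j := by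
      rw [← mul_assoc, hι s, mul_assoc, ht, Finset.mul_sum]
      simp only [map_mul, mul_assoc]
    rw [LinearMap.comp_apply, LinearMap.comp_apply, LinearMap.mulLeft_apply,
      LinearMap.mulLeft_apply, ht', ht, hh', hh', Finset.mul_sum]
    refine Finset.sum_congr rfl fun j _ => ?_
    rw [mul_smul_comm, ← mul_assoc, ← mul_assoc, hcomm b]
  · obtain ⟨t, ht⟩ := hsV 1 h1
    have hε := congr(counit (R := k) $ht)
    rw [LinearMap.comp_apply, LinearMap.mulLeft_apply, ht, hh']
    simp only [mul_one, hιε, hs, map_sum, Bialgebra.counit_mul] at hε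
    rw [hε, map_sum]
    refine Finset.sum_congr rfl fun j _ => ?_
    rw [map_smul, Bialgebra.counit_mul, Bialgebra.counit_pow, hs, one_pow, one_mul, smul_eq_mul,
      _root_.mul_comm]

/-- If `B` is a central Hopf subalgebra of a noetherian Hopf algebra `A`, then `B → A` has local
retractions: maps that are `B`-linear on a given finite subset. -/
theorem exists_local_retraction (ι : B →ₐc[k] A) (hinj : Function.Injective ι)
    (hι : IsCentralMap ι) (hnoeth : IsNoetherianRing A) (X : Finset A) :
    ∃ φ : A →ₗ[k] B, (∀ b, ∀ x ∈ X, φ (ι b * x) = b * φ x) ∧ ∀ b, φ (ι b) = b := by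
  classical
  have hcomm := hι.mul_comm hinj
  obtain ⟨V, hfg, hXV, hV⟩ := exists_isLeftCoideal_ge (k := k) (insert 1 X)
  have h1 : (1 : A) ∈ V := hXV 1 (Finset.mem_insert_self _ _)
  obtain ⟨φ, hφ, hφ1⟩ := exists_semilinear_counit_eq_one ι hinj hι hnoeth V hfg hV h1
  obtain ⟨ρ, hρ⟩ := LinearMap.exists_leftInverse_of_injective (ι : B →ₗ[k] A)
    (LinearMap.ker_eq_bot.2 hinj)
  have hρ' : ∀ b, ρ (ι b) = b := fun b => LinearMap.congr_fun hρ b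
  let i₁ : A →ₐ[k] A ⊗[k] B := Algebra.TensorProduct.includeLeft
  let i₂ : B →ₐ[k] A ⊗[k] B := Algebra.TensorProduct.includeRight
  -- J(b) = ι(b₍₁₎) ⊗ b₍₂₎. Multiplying by the antipode of the left leg strips it off:
  -- S(ιb₍₁₎)·J(b₍₂₎) = 1 ⊗ b.
  let J : B →ₐ[k] A ⊗[k] B :=
    (Algebra.TensorProduct.map (ι : B →ₐ[k] A) (AlgHom.id k B)).comp (Bialgebra.comulAlgHom k B)
  have hJ : toConv J.toLinearMap =
      toConv (i₁.toLinearMap ∘ₗ (ι : B →ₗ[k] A)) * toConv i₂.toLinearMap := by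
    apply WithConv.ofConv_injective
    change _ = LinearMap.mul' k _ ∘ₗ TensorProduct.map _ _ ∘ₗ comul
    have h : TensorProduct.map (ι : B →ₗ[k] A) LinearMap.id = LinearMap.mul' k (A ⊗[k] B) ∘ₗ
        TensorProduct.map (i₁.toLinearMap ∘ₗ (ι : B →ₗ[k] A)) i₂.toLinearMap := by
      ext x y; simp [i₁, i₂]
    rw [← LinearMap.comp_assoc, ← h]
    rfl
  have hinv : toConv (i₁.toLinearMap ∘ₗ antipode k ∘ₗ (ι : B →ₗ[k] A)) * toConv J.toLinearMap =
      toConv i₂.toLinearMap := by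
    have h : toConv (i₁.toLinearMap ∘ₗ antipode k ∘ₗ (ι : B →ₗ[k] A)) *
        toConv (i₁.toLinearMap ∘ₗ (ι : B →ₗ[k] A)) = 1 := by
      have h2 : antipode k ∘ₗ (ι : B →ₗ[k] A) = (ι : B →ₗ[k] A) ∘ₗ antipode k :=
        LinearMap.ext fun b => (antipode_map ι b).symm
      have h3 := LinearMap.algHom_comp_convMul_distrib (i₁.comp (ι : B →ₐ[k] A))
        (toConv (antipode k)) (toConv LinearMap.id)
      rw [LinearMap.antipode_mul_id, LinearMap.algHom_comp_convOne] at h3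
      rw [h2]
      exact (WithConv.ofConv_injective h3).symm
    rw [hJ, ← mul_assoc, h, one_mul]
  -- T(x) = (S(x₍₁₎) ⊗ 1) J(φ(x₍₂₎)) is B-linear on V for the action on the right leg alone. At 1 it
  -- equals J(φ(1)).
  let T : WithConv (A →ₗ[k] A ⊗[k] B) :=
    toConv (i₁.toLinearMap ∘ₗ antipode k) * toConv (J.toLinearMap ∘ₗ φ)
  -- N(a ⊗ b) = S(ρ(a)) b is also B-linear in the right leg and satisfies N(J(b)) = S(b₍₁₎)b₍₂₎ =
  -- ε(b). Hence N ∘ T sends 1 to ε(φ(1)) = 1.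
  let N : A ⊗[k] B →ₗ[k] B := LinearMap.mul' k B ∘ₗ LinearMap.rTensor B (antipode k ∘ₗ ρ)
  have hN : ∀ b t, N (i₂ b * t) = b * N t := by
    intro b t
    induction t with
    | zero => simp
    | add x y hx hy => simp only [mul_add, map_add, hx, hy]
    | tmul x y =>
      simp only [N, i₂, Algebra.TensorProduct.includeRight_apply,
        Algebra.TensorProduct.tmul_mul_tmul, one_mul, LinearMap.comp_apply,
        LinearMap.rTensor_tmul, LinearMap.mul'_apply]
      rw [← mul_assoc, ← mul_assoc, hcomm b]
  have hT : ∀ b, ∀ x ∈ V, T.ofConv (ι b * x) = i₂ b * T.ofConv x := by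
    intro b x hx
    obtain ⟨S, hS⟩ := hV.exists_sum hx
    let R := ℛ k b
    have hb := comul_map_eq_sum ι R
    have hib : ∑ i ∈ R.index, i₁ (antipode k (ι (R.left i))) * J (R.right i) = i₂ b := by
      have h := congr($(hinv).ofConv b)
      change LinearMap.mul' k _ (TensorProduct.map _ _ (comul (R := k) b)) = _ at h
      rw [← R.eq, map_sum, map_sum] at h
      exact h
    have hx' : T.ofConv x = ∑ p ∈ S, i₁ (antipode k p.1) * J (φ p.2) := by
      change LinearMap.mul' k _ (TensorProduct.map _ _ (comul (R := k) x)) = _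
      rw [hS, map_sum, map_sum]
      rfl
    have hbx : T.ofConv (ι b * x) = ∑ p ∈ S, ∑ i ∈ R.index,
        i₁ (antipode k (ι (R.left i) * p.1)) * J (φ (ι (R.right i) * (p.2 : A))) := by
      change LinearMap.mul' k _ (TensorProduct.map _ _ (comul (R := k) (ι b * x))) = _
      rw [Bialgebra.comul_mul, hb, hS, Finset.sum_mul_sum, Finset.sum_comm]
      simp only [map_sum, Algebra.TensorProduct.tmul_mul_tmul, TensorProduct.map_tmul]
      rfl
    rw [hbx, hx', Finset.mul_sum]
    refine Finset.sum_congr rfl fun p _ => ?_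
    have hcen : i₁ (antipode k p.1) * i₂ b = i₂ b * i₁ (antipode k p.1) := by
      simp [i₁, i₂]
    rw [← mul_assoc, ← hcen, ← hib, Finset.mul_sum, Finset.sum_mul]
    refine Finset.sum_congr rfl fun i _ => ?_
    rw [hφ _ _ p.2.2, antipode_mul_antidistrib, map_mul, map_mul, mul_assoc, mul_assoc, mul_assoc]
  have hT1 : T.ofConv 1 = J (φ 1) := by
    change LinearMap.mul' k _ (TensorProduct.map _ _ (comul (R := k) (1 : A))) = _
    rw [Bialgebra.comul_one, Algebra.TensorProduct.one_def]
    simp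
  have hNJ : ∀ b, N (J b) = algebraMap k B (counit (R := k) b) := by
    intro b
    rw [← mul_antipode_rTensor_comul_apply]
    have h : N ∘ₗ TensorProduct.map (ι : B →ₗ[k] A) LinearMap.id =
        LinearMap.mul' k B ∘ₗ LinearMap.rTensor B (antipode k) := by
      ext x y; simp [N, hρ']
    exact LinearMap.congr_fun h _
  have hmul : ∀ b, ∀ x ∈ V, (N ∘ₗ T.ofConv) (ι b * x) = b * (N ∘ₗ T.ofConv) x := by
    intro b x hx
    change N _ = b * N _
    rw [hT b x hx, hN]
  refine ⟨N ∘ₗ T.ofConv, fun b x hx => hmul b x (hXV x (Finset.mem_insert_of_mem hx)), fun b => ?_⟩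
  have h := hmul b 1 h1
  rw [mul_one] at h
  rw [h, LinearMap.comp_apply, hT1, hNJ, hφ1, map_one, mul_one]

end Retraction

/-! ### Exactness of the pushout sequence. -/

section PushoutExact

open WithConv

variable {k B A H K : Type*} [Field k] [Ring B] [HopfAlgebra k B] [Ring A] [HopfAlgebra k A]
  [Ring H] [HopfAlgebra k H] [Ring K] [HopfAlgebra k K]

theorem exists_sum_of_mem_span (ι : B →ₐc[k] A) (s : Set B) {x : A}
    (hx : x ∈ Ideal.span (ι '' s)) :
    ∃ (n : ℕ) (a : Fin n → A) (c : Fin n → B), (∀ i, c i ∈ s) ∧ x = ∑ i, a i * ι (c i) := by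
  obtain ⟨n, f, g, hfg⟩ := Submodule.mem_span_set'.1 hx
  choose c hc hcg using fun i => (g i).2
  exact ⟨n, f, c, hc, by rw [← hfg]; simp only [hcg, smul_eq_mul]⟩

theorem Pushout.q_eq_zero_iff (ι : B →ₐc[k] A) (p : B →ₐc[k] K) {a : A} :
    Pushout.q ι p a = 0 ↔ a ∈ pushoutIdeal ι p :=
  Ideal.Quotient.eq_zero_iff_mem

theorem Pushout.q_surjective (ι : B →ₐc[k] A) (p : B →ₐc[k] K) :
    Function.Surjective (Pushout.q ι p) :=
  Ideal.Quotient.mk_surjective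

/-- If ι(b) = Σ aᵢ ι(cᵢ) with p(cᵢ) = 0, a retraction that is B-linear on the aᵢ gives b = Σ cᵢ
φ(aᵢ), which lies in ker p. -/
theorem Pushout.j_injective (ι : B →ₐc[k] A) (hinj : Function.Injective ι) (hι : IsCentralMap ι)
    (hnoeth : IsNoetherianRing A) (p : B →ₐc[k] K) (hp : Function.Surjective p) :
    Function.Injective (Pushout.j ι p hp) := by
  classical
  rw [injective_iff_map_eq_zero]
  intro x hx
  obtain ⟨b, rfl⟩ := hp x
  rw [Pushout.j_apply, Pushout.q_eq_zero_iff, pushoutIdeal_eq_span ι p hι] at hx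
  obtain ⟨n, a, c, hc, hb⟩ := exists_sum_of_mem_span ι _ hx
  obtain ⟨φ, hφ, hφι⟩ := exists_local_retraction ι hinj hι hnoeth (Finset.univ.image a)
  have h : b = ∑ i, c i * φ (a i) := by
    rw [← hφι b, hb, map_sum]
    refine Finset.sum_congr rfl fun i _ => ?_
    rw [← hι, hφ _ _ (Finset.mem_image_of_mem a (Finset.mem_univ i))]
  rw [h, map_sum]
  refine Finset.sum_eq_zero fun i _ => ?_
  rw [map_mul, show p (c i) = 0 from hc i, zero_mul]

/-- The map `x ⊗ y ↦ x₍₁₎ φ(S(x₍₂₎) y)`. -/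
noncomputable def twist (φ : A →ₗ[k] A) : A ⊗[k] A →ₗ[k] A :=
  LinearMap.mul' k A ∘ₗ LinearMap.lTensor A (φ ∘ₗ LinearMap.mul' k A ∘ₗ
    LinearMap.rTensor A (antipode k)) ∘ₗ (TensorProduct.assoc k A A A).toLinearMap ∘ₗ
    LinearMap.rTensor A comul

theorem twist_tmul (φ : A →ₗ[k] A) {x : A} (y : A) {α : Type*} {S : Finset α} {l r : α → A}
    (h : comul (R := k) x = ∑ i ∈ S, l i ⊗ₜ[k] r i) :
    twist φ (x ⊗ₜ y) = ∑ i ∈ S, l i * φ (antipode k (r i) * y) := by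
  simp only [twist, LinearMap.comp_apply, LinearMap.rTensor_tmul, h, TensorProduct.sum_tmul,
    map_sum, LinearEquiv.coe_coe, TensorProduct.assoc_tmul, LinearMap.lTensor_tmul,
    LinearMap.mul'_apply]

theorem twist_comul (φ : A →ₗ[k] A) (hφ : φ 1 = 1) (a : A) :
    twist φ (comul (R := k) a) = a := by
  have h : (φ ∘ₗ LinearMap.mul' k A ∘ₗ LinearMap.rTensor A (antipode k)) ∘ₗ comul =
      Algebra.linearMap k A ∘ₗ counit := by
    ext x
    simp only [LinearMap.comp_apply, mul_antipode_rTensor_comul_apply,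
      Algebra.algebraMap_eq_smul_one, map_smul, hφ, Algebra.linearMap_apply]
  simp only [twist, LinearMap.comp_apply, LinearEquiv.coe_coe]
  rw [Coalgebra.coassoc_apply, ← LinearMap.comp_apply (LinearMap.lTensor A _),
    ← LinearMap.lTensor_comp, h]
  have h1 := congr($(mul_one (toConv (LinearMap.id : A →ₗ[k] A))).ofConv a)
  exact h1

theorem twist_one_tmul (φ : A →ₗ[k] A) (a : A) : twist φ (1 ⊗ₜ a) = φ a := by
  simp [twist, Algebra.TensorProduct.one_def]

/-- By coinvariance Δ(a) - 1 ⊗ a lies in ker π ⊗ A + A ⊗ ker q. For a retraction φ that is B-linear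
where needed, the twist by ιφ maps this space into the pushout ideal, while it sends Δ(a) - 1 ⊗ a to
a - ιφ(a). So φ(a) is the required element of B. -/
theorem exists_q_eq_of_coinvariant (ι : B →ₐc[k] A) (π : A →ₐc[k] H) (hexact : IsExactSeq ι π)
    (hι : IsCentralMap ι) (hnoeth : IsNoetherianRing A) (p : B →ₐc[k] K) {a : A}
    (ha : TensorProduct.map (π : A →ₗ[k] H) (Pushout.q ι p : A →ₗ[k] Pushout ι p)
      (comul (R := k) a) = 1 ⊗ₜ Pushout.q ι p a) :
    ∃ b : B, Pushout.q ι p a = Pushout.q ι p (ι b) := by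
  classical
  let q := Pushout.q ι p
  -- Retractions are only B-linear on finite sets, so P records a finite set that suffices for t.
  -- The retraction is chosen once the sets for all summands are united.
  let P : A ⊗[k] A → Prop := fun t => ∃ X : Finset A, ∀ φ : A →ₗ[k] B,
    (∀ b, ∀ x ∈ X, φ (ι b * x) = b * φ x) →
      twist ((ι : B →ₗ[k] A) ∘ₗ φ) t ∈ pushoutIdeal ι p
  have hP0 : P 0 := ⟨∅, fun φ _ => by rw [map_zero]; exact zero_mem _⟩
  have hPadd : ∀ s t, P s → P t → P (s + t) := by
    rintro s t ⟨X, hX⟩ ⟨Y, hY⟩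
    refine ⟨X ∪ Y, fun φ hφ => ?_⟩
    rw [map_add]
    exact add_mem (hX φ fun b x hx => hφ b x (Finset.mem_union_left _ hx))
      (hY φ fun b x hx => hφ b x (Finset.mem_union_right _ hx))
  have hPsum : ∀ (n : ℕ) (t : Fin n → A ⊗[k] A), (∀ i, P (t i)) → P (∑ i, t i) := by
    intro n t ht
    exact Finset.sum_induction _ P hPadd hP0 fun i _ => ht i
  have hleft : ∀ z y, ∀ c : B, counit (R := k) c = 0 → P ((z * ι c) ⊗ₜ y) := by
    intro z y c hc
    let Z := ℛ k z
    let R := ℛ k c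
    refine ⟨Z.index.image fun i => antipode k (Z.right i) * y, fun φ hφ => ?_⟩
    have hcom : comul (R := k) (z * ι c) = ∑ i ∈ Z.index ×ˢ R.index,
        (Z.left i.1 * ι (R.left i.2)) ⊗ₜ[k] (Z.right i.1 * ι (R.right i.2)) := by
      rw [Bialgebra.comul_mul, comul_map_eq_sum ι R, ← Z.eq, Finset.sum_mul_sum,
        Finset.sum_product]
      simp only [Algebra.TensorProduct.tmul_mul_tmul]
    -- Linearity of φ pulls S(c₍₂₎) out next to c₍₁₎, and c₍₁₎S(c₍₂₎) = ε(c) = 0.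
    have hz : twist ((ι : B →ₗ[k] A) ∘ₗ φ) ((z * ι c) ⊗ₜ y) = 0 := by
      rw [twist_tmul _ _ hcom, Finset.sum_product]
      refine Finset.sum_eq_zero fun i hi => ?_
      have hterm : ∀ j ∈ R.index, Z.left i * ι (R.left j) * ((ι : B →ₗ[k] A) ∘ₗ φ)
          (antipode k (Z.right i * ι (R.right j)) * y) =
          Z.left i * (ι (R.left j * antipode k (R.right j)) *
            ι (φ (antipode k (Z.right i) * y))) := by
        intro j _
        have h := hφ (antipode k (R.right j)) _ (Finset.mem_image_of_mem
          (fun i => antipode k (Z.right i) * y) hi)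
        rw [antipode_mul_antidistrib, ← antipode_map, mul_assoc (ι _)]
        change _ * ι (φ _) = _
        rw [h, map_mul ι, map_mul ι]
        simp only [mul_assoc]
      rw [Finset.sum_congr rfl hterm, ← Finset.mul_sum, ← Finset.sum_mul, ← map_sum,
        sum_mul_antipode_eq_algebraMap_counit R, hc, map_zero, map_zero, zero_mul, mul_zero]
    rw [hz]
    exact zero_mem _
  have hright : ∀ x w, ∀ c : B, p c = 0 → P (x ⊗ₜ (w * ι c)) := by
    intro x w c hc
    let R := ℛ k x
    refine ⟨R.index.image fun i => antipode k (R.right i) * w, fun φ hφ => ?_⟩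
    rw [twist_tmul _ _ R.eq.symm]
    refine sum_mem fun i hi => Ideal.mul_mem_left _ _ ?_
    have h := hφ c _ (Finset.mem_image_of_mem (fun i => antipode k (R.right i) * w) hi)
    rw [← mul_assoc, ← hι]
    change ι (φ _) ∈ _
    rw [h, map_mul]
    exact Ideal.mul_mem_right _ _ (map_mem_pushoutIdeal ι p hc)
  have hl : ∀ s, P (LinearMap.lTensor A (LinearMap.ker (q : A →ₗ[k] Pushout ι p)).subtype s) := by
    intro s
    induction s with
    | zero => rw [map_zero]; exact hP0
    | add _ _ h1 h2 => rw [map_add]; exact hPadd _ _ h1 h2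
    | tmul x y =>
      obtain ⟨n, w, c, hc, hyc⟩ := exists_sum_of_mem_span ι _
        ((pushoutIdeal_eq_span ι p hι).le ((Pushout.q_eq_zero_iff ι p).1 y.2))
      rw [LinearMap.lTensor_tmul, Submodule.subtype_apply, hyc, TensorProduct.tmul_sum]
      exact hPsum _ _ fun i => hright _ _ _ (hc i)
  have hr : ∀ s, P (LinearMap.rTensor A (LinearMap.ker (π : A →ₗ[k] H)).subtype s) := by
    intro s
    induction s with
    | zero => rw [map_zero]; exact hP0
    | add _ _ h1 h2 => rw [map_add]; exact hPadd _ _ h1 h2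
    | tmul x y =>
      have hx : (x : A) ∈ RingHom.ker π := x.2
      rw [hexact.ker_eq] at hx
      obtain ⟨n, w, c, hc, hxc⟩ := exists_sum_of_mem_span ι _ hx
      rw [LinearMap.rTensor_tmul, Submodule.subtype_apply, hxc, TensorProduct.sum_tmul]
      exact hPsum _ _ fun i => hleft _ _ _ (hc i)
  have hker : ∀ t, TensorProduct.map (π : A →ₗ[k] H) (q : A →ₗ[k] Pushout ι p) t = 0 → P t := by
    intro t ht
    have hk := TensorProduct.map_ker (LinearMap.exact_subtype_ker_map (π : A →ₗ[k] H))
      hexact.surjective (LinearMap.exact_subtype_ker_map (q : A →ₗ[k] Pushout ι p))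
      (Pushout.q_surjective ι p)
    have ht' := LinearMap.mem_ker.2 ht
    rw [hk] at ht'
    obtain ⟨_, ⟨s, rfl⟩, _, ⟨s', rfl⟩, rfl⟩ := Submodule.mem_sup.1 ht'
    exact hPadd _ _ (hl s) (hr s')
  obtain ⟨X, hX⟩ := hker (comul (R := k) a - 1 ⊗ₜ a) (by
    rw [map_sub, ha, TensorProduct.map_tmul, sub_eq_zero]
    change _ = π 1 ⊗ₜ _
    rw [map_one]
    rfl)
  obtain ⟨φ, hφ, hφι⟩ := exists_local_retraction ι hexact.injective hι hnoeth X
  have h := hX φ hφ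
  have h1 : ((ι : B →ₗ[k] A) ∘ₗ φ) 1 = 1 := by
    change ι (φ 1) = 1
    rw [← map_one ι, hφι]
  rw [map_sub, twist_comul _ h1, twist_one_tmul] at h
  refine ⟨φ a, ?_⟩
  rw [← sub_eq_zero, ← map_sub]
  exact (Pushout.q_eq_zero_iff ι p).2 h

end PushoutExact

/-! ### Convolution calculus. -/

section Convolution

open WithConv

variable {k A C D : Type*} [Field k] [Ring A] [HopfAlgebra k A] [Ring C] [Algebra k C]
  [Ring D] [Algebra k D]

theorem toConv_map_comp_comul (α : A →ₗ[k] C) (β : A →ₗ[k] D) :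
    toConv (TensorProduct.map α β ∘ₗ comul) =
      toConv ((Algebra.TensorProduct.includeLeft : C →ₐ[k] C ⊗[k] D).toLinearMap ∘ₗ α) *
      toConv ((Algebra.TensorProduct.includeRight : D →ₐ[k] C ⊗[k] D).toLinearMap ∘ₗ β) := by
  apply WithConv.ofConv_injective
  change _ = LinearMap.mul' k _ ∘ₗ TensorProduct.map _ _ ∘ₗ comul
  rw [← LinearMap.comp_assoc]
  refine congrArg (· ∘ₗ comul) ?_
  ext x y
  simp

theorem toConv_comp_mul {f g h : A →ₗ[k] C} (e : C →ₐ[k] D)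
    (hf : toConv f = toConv g * toConv h) :
    toConv (e.toLinearMap ∘ₗ f) = toConv (e.toLinearMap ∘ₗ g) * toConv (e.toLinearMap ∘ₗ h) := by
  have h1 := LinearMap.algHom_comp_convMul_distrib e (toConv g) (toConv h)
  rw [← hf] at h1
  exact WithConv.ofConv_injective h1

theorem toConv_comp_one (e : C →ₐ[k] D) :
    toConv (e.toLinearMap ∘ₗ (1 : WithConv (A →ₗ[k] C)).ofConv) = 1 := by
  ext a
  simp

theorem toConv_mul_comp {B : Type*} [Ring B] [HopfAlgebra k B] {f g h : A →ₗ[k] C} (ι : B →ₐc[k] A)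
    (hf : toConv f = toConv g * toConv h) :
    toConv (f ∘ₗ (ι : B →ₗ[k] A)) =
      toConv (g ∘ₗ (ι : B →ₗ[k] A)) * toConv (h ∘ₗ (ι : B →ₗ[k] A)) := by
  have h1 := LinearMap.convMul_comp_coalgHom_distrib (toConv g) (toConv h) (ι : B →ₗc[k] A)
  rw [← hf] at h1
  exact WithConv.ofConv_injective h1

theorem toConv_comp_antipode_mul (α : A →ₐ[k] C) :
    toConv (α.toLinearMap ∘ₗ antipode k) * toConv α.toLinearMap = 1 := by
  have h := LinearMap.algHom_comp_convMul_distrib α (toConv (antipode k)) (toConv LinearMap.id)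
  rw [LinearMap.antipode_mul_id] at h
  exact (WithConv.ofConv_injective h).symm.trans (toConv_comp_one α)

theorem toConv_mul_comp_antipode (α : A →ₐ[k] C) :
    toConv α.toLinearMap * toConv (α.toLinearMap ∘ₗ antipode k) = 1 := by
  have h := LinearMap.algHom_comp_convMul_distrib α (toConv LinearMap.id) (toConv (antipode k))
  rw [LinearMap.id_mul_antipode] at h
  exact (WithConv.ofConv_injective h).symm.trans (toConv_comp_one α)

/-- The convolution product of two algebra maps with commuting images. -/
noncomputable def convHom (α β : A →ₐ[k] C) (h : ∀ a b, Commute (α a) (β b)) : A →ₐ[k] C :=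
  (Algebra.TensorProduct.lift α β h).comp (Bialgebra.comulAlgHom k A)

theorem toConv_convHom (α β : A →ₐ[k] C) (h : ∀ a b, Commute (α a) (β b)) :
    toConv (convHom α β h).toLinearMap = toConv α.toLinearMap * toConv β.toLinearMap := by
  apply WithConv.ofConv_injective
  change (Algebra.TensorProduct.lift α β h).toLinearMap ∘ₗ comul = LinearMap.mul' k _ ∘ₗ TensorProduct.map _ _ ∘ₗ comul
  rw [← LinearMap.comp_assoc]
  refine congrArg (· ∘ₗ comul) ?_
  ext x y
  simp

/-- The map `α ∘ S`, for an algebra map `α` with commutative image. -/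
noncomputable def compAntipode (α : A →ₐ[k] C) (h : ∀ a b, Commute (α a) (α b)) : A →ₐ[k] C :=
  .ofLinearMap (α.toLinearMap ∘ₗ antipode k) (by simp) (fun x y => by
    simp only [LinearMap.comp_apply, antipode_mul_antidistrib, AlgHom.toLinearMap_apply, map_mul]
    exact h _ _)

/-- The right-hand side of `Compat₂` as a convolution product. -/
theorem toConv_compatMap₂ (q : A →ₐ[k] C) (F : A ≃ₐc[k] A) (u : A →ₐ[k] C) :
    let l : C →ₐ[k] C ⊗[k] C := Algebra.TensorProduct.includeLeft
    let r : C →ₐ[k] C ⊗[k] C := Algebra.TensorProduct.includeRight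
    let x : A →ₐ[k] C ⊗[k] C := r.comp (q.comp (F : A →ₐ[k] A))
    toConv (compatMap₂ q F u ∘ₗ comul₄ k A) =
      toConv (x.toLinearMap ∘ₗ antipode k) * (toConv (l.comp u).toLinearMap *
        (toConv x.toLinearMap * toConv (r.comp u).toLinearMap)) := by
  intro l r x
  apply WithConv.ofConv_injective
  have h : compatMap₂ q F u = LinearMap.mul' k _ ∘ₗ TensorProduct.map (x.toLinearMap ∘ₗ antipode k)
      (LinearMap.mul' k _ ∘ₗ TensorProduct.map (l.comp u).toLinearMap
        (LinearMap.mul' k _ ∘ₗ TensorProduct.map x.toLinearMap (r.comp u).toLinearMap)) := by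
    ext a b c d
    simp [compatMap₂, l, r, x, mul_assoc]
  change _ = LinearMap.mul' k _ ∘ₗ TensorProduct.map _ (LinearMap.mul' k _ ∘ₗ TensorProduct.map _
    (LinearMap.mul' k _ ∘ₗ TensorProduct.map _ _ ∘ₗ comul) ∘ₗ comul) ∘ₗ comul
  change compatMap₂ q F u ∘ₗ comul₄ k A = _
  rw [h, comul₄]
  ext a
  simp only [LinearMap.comp_apply]
  congr 1
  generalize comul (R := k) a = t
  induction t with
  | zero => simp
  | add s t hs ht => simp only [map_add, hs, ht]
  | tmul a b =>
    simp only [LinearMap.lTensor_tmul, TensorProduct.map_tmul, LinearMap.comp_apply]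
    congr 2
    generalize comul (R := k) b = t
    induction t with
    | zero => simp
    | add s t hs ht => simp only [map_add, hs, ht]
    | tmul a b => simp only [LinearMap.lTensor_tmul, TensorProduct.map_tmul, LinearMap.comp_apply]

end Convolution

/-! ### When a convolution product is a coalgebra map. -/

section Bialgebra

open WithConv

variable {k A C : Type*} [Field k] [Ring A] [HopfAlgebra k A] [Ring C] [Bialgebra k C]

/-- Applying ε ⊗ ε to the identity removes x and leaves εU = εU * εU. Since εU is an algebra map it
is convolution invertible, so it is the unit. -/
theorem counit_eq_of_comul_eq (x : A →ₐc[k] C) (U : A →ₐ[k] C)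
    (hU : let l : C →ₐ[k] C ⊗[k] C := Algebra.TensorProduct.includeLeft
      let r : C →ₐ[k] C ⊗[k] C := Algebra.TensorProduct.includeRight
      let y : A →ₐ[k] C ⊗[k] C := r.comp (x : A →ₐ[k] C)
      toConv (comul ∘ₗ U.toLinearMap) =
        toConv (y.toLinearMap ∘ₗ antipode k) * (toConv (l.comp U).toLinearMap *
          (toConv y.toLinearMap * toConv (r.comp U).toLinearMap))) (a : A) :
    counit (R := k) (U a) = counit (R := k) a := by
  extract_lets l r y at hU
  let ε : C →ₐ[k] k := Bialgebra.counitAlgHom k C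
  let εε : C ⊗[k] C →ₐ[k] k := Algebra.TensorProduct.lift ε ε fun _ _ => Commute.all _ _
  have hl : εε.comp l = ε := by ext a; simp [εε, l]
  have hr : εε.comp r = ε := by ext a; simp [εε, r]
  have hcom : εε.toLinearMap ∘ₗ comul = ε.toLinearMap := by
    have h1 : εε.toLinearMap = ε.toLinearMap ∘ₗ
        (TensorProduct.lid k C).toLinearMap ∘ₗ LinearMap.rTensor _ counit := by
      ext a b
      simp [εε, ε]
    rw [h1]
    ext a
    simp
  have hx : toConv (ε.comp (x : A →ₐ[k] C)).toLinearMap = 1 := by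
    ext a
    exact CoalgHomClass.counit_comp_apply x a
  have hxS : toConv ((ε.comp (x : A →ₐ[k] C)).toLinearMap ∘ₗ antipode k) = 1 := by
    have h := toConv_comp_antipode_mul (ε.comp (x : A →ₐ[k] C))
    rwa [hx, mul_one] at h
  have e₁ : εε.toLinearMap ∘ₗ comul ∘ₗ U.toLinearMap = (ε.comp U).toLinearMap := by
    rw [← LinearMap.comp_assoc, hcom]; rfl
  have e₂ : εε.toLinearMap ∘ₗ y.toLinearMap ∘ₗ antipode k =
      (ε.comp (x : A →ₐ[k] C)).toLinearMap ∘ₗ antipode k := by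
    rw [← hr]; rfl
  have e₃ : εε.toLinearMap ∘ₗ (l.comp U).toLinearMap = (ε.comp U).toLinearMap := by
    rw [← hl]; rfl
  have e₄ : εε.toLinearMap ∘ₗ y.toLinearMap = (ε.comp (x : A →ₐ[k] C)).toLinearMap := by
    rw [← hr]; rfl
  have e₅ : εε.toLinearMap ∘ₗ (r.comp U).toLinearMap = (ε.comp U).toLinearMap := by
    rw [← hr]; rfl
  have h := congrArg (fun f => toConv (εε.toLinearMap ∘ₗ f.ofConv)) hU
  simp only [LinearMap.algHom_comp_convMul_distrib, WithConv.toConv_ofConv,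
    WithConv.ofConv_toConv, e₁, e₂, e₃, e₄, e₅, hx, hxS, one_mul] at h
  have hinv := toConv_comp_antipode_mul (ε.comp U)
  have h2 := congrArg (toConv ((ε.comp U).toLinearMap ∘ₗ antipode k) * ·) h
  simp only [← mul_assoc, hinv, one_mul] at h2
  exact congr($(h2).ofConv a).symm

/-- Sufficient conditions for a convolution product of a bialgebra map `x` and an algebra map `U`
to be a coalgebra map. -/
theorem counit_and_comul_of_comul_eq (x : A →ₐc[k] C) (U Ω : A →ₐ[k] C)
    (hU : let l : C →ₐ[k] C ⊗[k] C := Algebra.TensorProduct.includeLeft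
      let r : C →ₐ[k] C ⊗[k] C := Algebra.TensorProduct.includeRight
      let y : A →ₐ[k] C ⊗[k] C := r.comp (x : A →ₐ[k] C)
      toConv (comul ∘ₗ U.toLinearMap) =
        toConv (y.toLinearMap ∘ₗ antipode k) * (toConv (l.comp U).toLinearMap *
          (toConv y.toLinearMap * toConv (r.comp U).toLinearMap)))
    (hΩ : toConv Ω.toLinearMap =
      toConv (x : A →ₐ[k] C).toLinearMap * toConv U.toLinearMap) (a : A) :
    counit (R := k) (Ω a) = counit (R := k) a ∧
      comul (R := k) (Ω a) = TensorProduct.map Ω.toLinearMap Ω.toLinearMap (comul (R := k) a) := by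
  have hUε := counit_eq_of_comul_eq x U hU
  extract_lets l r y at hU
  constructor
  · have h := toConv_comp_mul (Bialgebra.counitAlgHom k C) hΩ
    have e₁ : toConv ((Bialgebra.counitAlgHom k C).toLinearMap ∘ₗ
        (x : A →ₐ[k] C).toLinearMap) = 1 := by
      ext a
      exact CoalgHomClass.counit_comp_apply x a
    have e₂ : toConv ((Bialgebra.counitAlgHom k C).toLinearMap ∘ₗ U.toLinearMap) = 1 := by
      ext a
      exact hUε a
    rw [e₁, e₂, one_mul] at h
    exact congr($(h).ofConv a)
  · have hx : toConv (comul ∘ₗ (x : A →ₐ[k] C).toLinearMap) =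
        toConv (l.comp (x : A →ₐ[k] C)).toLinearMap * toConv y.toLinearMap := by
      have h : comul ∘ₗ (x : A →ₐ[k] C).toLinearMap =
          TensorProduct.map (x : A →ₐ[k] C).toLinearMap (x : A →ₐ[k] C).toLinearMap ∘ₗ comul :=
        (CoalgHomClass.map_comp_comul x).symm
      rw [h, toConv_map_comp_comul]
      rfl
    have hcom : (Bialgebra.comulAlgHom k C).toLinearMap = comul := rfl
    have h := toConv_comp_mul (Bialgebra.comulAlgHom k C) hΩ
    rw [hcom] at h
    have hl := toConv_comp_mul l hΩ
    have hr := toConv_comp_mul r hΩ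
    rw [← AlgHom.comp_toLinearMap (x : A →ₐ[k] C) l, ← AlgHom.comp_toLinearMap U l] at hl
    rw [← AlgHom.comp_toLinearMap (x : A →ₐ[k] C) r, ← AlgHom.comp_toLinearMap U r] at hr
    have hinv := toConv_mul_comp_antipode y
    -- With l, r the two inclusions into C ⊗ C, ΔΩ = lx * rx * (rx)⁻¹ * lU * rx * rU = lΩ * rΩ.
    have hfin : toConv (comul ∘ₗ Ω.toLinearMap) =
        toConv (TensorProduct.map Ω.toLinearMap Ω.toLinearMap ∘ₗ comul) := by
      rw [toConv_map_comp_comul, hl, hr, h, hx, hU, mul_assoc,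
        ← mul_assoc (toConv y.toLinearMap) (toConv (_ ∘ₗ antipode k)), hinv, one_mul, mul_assoc]
    exact congr($(hfin).ofConv a)

end Bialgebra

/-! ### Centrality in the pushout and the second identity in convolution form. -/

section Pushout

open WithConv

variable {k B A K : Type*} [Field k] [Ring B] [HopfAlgebra k B] [Ring A] [HopfAlgebra k A]
  [Ring K] [HopfAlgebra k K]

theorem Pushout.j_commute (ι : B →ₐc[k] A) (hι : IsCentralMap ι) (p : B →ₐc[k] K)
    (hp : Function.Surjective p) (x : K) (y : Pushout ι p) : Commute (Pushout.j ι p hp x) y := by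
  obtain ⟨b, rfl⟩ := hp x
  obtain ⟨a, rfl⟩ := Pushout.q_surjective ι p y
  rw [Pushout.j_apply, Commute, SemiconjBy, ← map_mul, ← map_mul, hι]

theorem compat₂_iff_toConv (ι : B →ₐc[k] A) (p : B →ₐc[k] K) (hp : Function.Surjective p)
    (F : A ≃ₐc[k] A) (u : A →ₐ[k] K) :
    let q : A →ₐ[k] Pushout ι p := Pushout.q ι p
    let U : A →ₐ[k] Pushout ι p := (Pushout.j ι p hp : K →ₐ[k] Pushout ι p).comp u
    let l : Pushout ι p →ₐ[k] Pushout ι p ⊗[k] Pushout ι p := Algebra.TensorProduct.includeLeft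
    let r : Pushout ι p →ₐ[k] Pushout ι p ⊗[k] Pushout ι p := Algebra.TensorProduct.includeRight
    let x : A →ₐ[k] Pushout ι p ⊗[k] Pushout ι p := r.comp (q.comp (F : A →ₐ[k] A))
    Compat₂ ι p hp F u ↔ toConv (comul ∘ₗ U.toLinearMap) =
      toConv (x.toLinearMap ∘ₗ antipode k) * (toConv (l.comp U).toLinearMap *
        (toConv x.toLinearMap * toConv (r.comp U).toLinearMap)) := by
  intro q U l r x
  rw [← toConv_compatMap₂ q F U, WithConv.toConv_injective.eq_iff, LinearMap.ext_iff]
  refine forall_congr' fun a => ?_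
  rw [CoalgHomClass.map_comp_comul_apply]
  rfl

end Pushout

/-! ### From a triple to an isomorphism. -/

section OfTriple

open WithConv

variable {k B A K₁ K₂ : Type*} [Field k] [Ring B] [HopfAlgebra k B] [Ring A]
  [HopfAlgebra k A] [Ring K₁] [HopfAlgebra k K₁] [Ring K₂] [HopfAlgebra k K₂]

/-- A compatible triple `(ω, g, u)` gives an isomorphism of pushouts. -/
theorem nonempty_bialgEquiv_of_compat (ι : B →ₐc[k] A) (hι : IsCentralMap ι)
    (p₁ : B →ₐc[k] K₁) (hp₁ : Function.Surjective p₁)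
    (p₂ : B →ₐc[k] K₂) (hp₂ : Function.Surjective p₂) (ω : K₁ ≃ₐc[k] K₂) (g : B ≃ₐc[k] B)
    (u : A →ₐ[k] K₂) (F : A ≃ₐc[k] A) (h₁ : Compat₁ ι p₁ p₂ ω g u) (hF : ∀ b, F (ι b) = ι (g b))
    (h₂ : Compat₂ ι p₂ hp₂ F u) : Nonempty (Pushout ι p₁ ≃ₐc[k] Pushout ι p₂) := by
  let q₁ : A →ₐ[k] Pushout ι p₁ := Pushout.q ι p₁
  let q₂ : A →ₐ[k] Pushout ι p₂ := Pushout.q ι p₂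
  let j₁ : K₁ →ₐ[k] Pushout ι p₁ := Pushout.j ι p₁ hp₁
  let j₂ : K₂ →ₐ[k] Pushout ι p₂ := Pushout.j ι p₂ hp₂
  have hj₁ : ∀ b, j₁ (p₁ b) = q₁ (ι b) := Pushout.j_apply ι p₁ hp₁
  have hj₂ : ∀ b, j₂ (p₂ b) = q₂ (ι b) := Pushout.j_apply ι p₂ hp₂
  let ω' : K₂ →ₐ[k] K₁ := (ω.symm : K₂ →ₐ[k] K₁)
  have hωω' : ∀ x, ω (ω' x) = x := ω.apply_symm_apply
  have hω'ω : ∀ x, ω' (ω x) = x := ω.symm_apply_apply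
  let x : A →ₐ[k] Pushout ι p₂ := q₂.comp (F : A →ₐ[k] A)
  let U : A →ₐ[k] Pushout ι p₂ := j₂.comp u
  let Ω : A →ₐ[k] Pushout ι p₂ := convHom x U fun _ _ => (Pushout.j_commute ι hι p₂ hp₂ _ _).symm
  have hΩ : toConv Ω.toLinearMap = toConv x.toLinearMap * toConv U.toLinearMap :=
    toConv_convHom _ _ _
  have h' : toConv ((ω : K₁ →ₗ[k] K₂) ∘ₗ (p₁ : B →ₗ[k] K₁)) =
      toConv ((p₂ : B →ₗ[k] K₂) ∘ₗ (g : B →ₗ[k] B)) *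
        toConv (u.toLinearMap ∘ₗ (ι : B →ₗ[k] A)) :=
    WithConv.ofConv_injective (LinearMap.ext h₁)
  have hΩι : ∀ b : B, Ω (ι b) = j₂ (ω (p₁ b)) := by
    have h := toConv_mul_comp ι hΩ
    have h'' := toConv_comp_mul j₂ h'
    have hx : x.toLinearMap ∘ₗ (ι : B →ₗ[k] A) =
        j₂.toLinearMap ∘ₗ (p₂ : B →ₗ[k] K₂) ∘ₗ (g : B →ₗ[k] B) :=
      LinearMap.ext fun b => (congrArg q₂ (hF b)).trans (hj₂ (g b)).symm
    rw [hx] at h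
    exact fun b => congr($(h.trans h''.symm).ofConv b)
  let V : A →ₐ[k] Pushout ι p₁ := j₁.comp (ω'.comp u)
  -- Solving Ω = x * U for x and transporting by the desired inverse suggests q₁ * (V ∘ S), with V
  -- the counterpart of U in the first pushout. It is what the inverse should do on x = q₂F, so
  -- precomposing with F⁻¹ gives the inverse itself.
  let G : A →ₐ[k] Pushout ι p₁ := convHom q₁ (compAntipode V fun _ _ =>
    Pushout.j_commute ι hι p₁ hp₁ _ _) fun _ _ => (Pushout.j_commute ι hι p₁ hp₁ _ _).symm
  have hG : toConv G.toLinearMap =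
      toConv q₁.toLinearMap * toConv (V.toLinearMap ∘ₗ antipode k) := toConv_convHom _ _ _
  have hGV : toConv G.toLinearMap * toConv V.toLinearMap = toConv q₁.toLinearMap := by
    rw [hG, mul_assoc, toConv_comp_antipode_mul, mul_one]
  have hΩU : toConv Ω.toLinearMap * toConv (U.toLinearMap ∘ₗ antipode k) =
      toConv x.toLinearMap := by
    rw [hΩ, mul_assoc, toConv_mul_comp_antipode, mul_one]
  have hGι : ∀ b : B, G (ι b) = j₁ (ω' (p₂ (g b))) := by
    have h := toConv_mul_comp ι hG
    have hS : (V.toLinearMap ∘ₗ antipode k) ∘ₗ (ι : B →ₗ[k] A) =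
        (V.comp (ι : B →ₐ[k] A)).toLinearMap ∘ₗ antipode k :=
      LinearMap.ext fun b => congrArg V (antipode_map ι b).symm
    have h'' := toConv_comp_mul (j₁.comp ω') h'
    have hq : q₁.toLinearMap ∘ₗ (ι : B →ₗ[k] A) =
        (j₁.comp ω').toLinearMap ∘ₗ (ω : K₁ →ₗ[k] K₂) ∘ₗ (p₁ : B →ₗ[k] K₁) :=
      LinearMap.ext fun b => (hj₁ b).symm.trans (congrArg j₁ (hω'ω _).symm)
    have hc : toConv ((j₁.comp ω').toLinearMap ∘ₗ u.toLinearMap ∘ₗ (ι : B →ₗ[k] A)) *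
        toConv ((V.comp (ι : B →ₐ[k] A)).toLinearMap ∘ₗ antipode k) = 1 :=
      toConv_mul_comp_antipode (V.comp (ι : B →ₐ[k] A))
    rw [hS, hq, h'', mul_assoc, hc, mul_one] at h
    exact fun b => congr($(h).ofConv b)
  let Φ : Pushout ι p₁ →ₐ[k] Pushout ι p₂ := Ideal.Quotient.liftₐ (pushoutIdeal ι p₁) Ω
    fun a ha => pushoutIdeal_le_ker ι p₁ Ω.toRingHom (fun b hb => by
      change Ω (ι b) = 0
      rw [hΩι, hb, map_zero, map_zero]) ha
  have hΦ : ∀ a, Φ (q₁ a) = Ω a := fun _ => rfl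
  let Γ : Pushout ι p₂ →ₐ[k] Pushout ι p₁ := Ideal.Quotient.liftₐ (pushoutIdeal ι p₂)
    (G.comp (F.symm : A →ₐ[k] A))
    fun a ha => pushoutIdeal_le_ker ι p₂ (G.comp (F.symm : A →ₐ[k] A)).toRingHom (fun b hb => by
      change G (F.symm (ι b)) = 0
      obtain ⟨c, rfl⟩ : ∃ c, g c = b := ⟨g.symm b, g.apply_symm_apply b⟩
      rw [← hF, BialgEquiv.symm_apply_apply, hGι, hb, map_zero, map_zero]) ha
  have hΓx : ∀ a, Γ (x a) = G a := fun a => congrArg G (F.symm_apply_apply a)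
  have hΓj : ∀ y, Γ (j₂ y) = j₁ (ω' y) := by
    intro y
    obtain ⟨b, rfl⟩ := hp₂ y
    obtain ⟨c, rfl⟩ : ∃ c, g c = b := ⟨g.symm b, g.apply_symm_apply b⟩
    rw [hj₂, ← hF, ← hGι]
    exact hΓx _
  have hΦj : ∀ y, Φ (j₁ y) = j₂ (ω y) := by
    intro y
    obtain ⟨b, rfl⟩ := hp₁ y
    rw [hj₁, hΦ, hΩι]
  have hΓΦ : ∀ a, Γ (Ω a) = q₁ a := by
    have h := toConv_comp_mul Γ hΩ
    have e₁ : Γ.toLinearMap ∘ₗ x.toLinearMap = G.toLinearMap := LinearMap.ext hΓx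
    have e₂ : Γ.toLinearMap ∘ₗ U.toLinearMap = V.toLinearMap := LinearMap.ext fun a => hΓj (u a)
    rw [e₁, e₂, hGV] at h
    exact fun a => congr($(h).ofConv a)
  have hΦΓ : ∀ a, Φ (G a) = x a := by
    have h := toConv_comp_mul Φ hG
    have e₁ : Φ.toLinearMap ∘ₗ q₁.toLinearMap = Ω.toLinearMap := LinearMap.ext hΦ
    have e₂ : Φ.toLinearMap ∘ₗ V.toLinearMap ∘ₗ antipode k = U.toLinearMap ∘ₗ antipode k :=
      LinearMap.ext fun a => (hΦj _).trans (congrArg j₂ (hωω' _))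
    rw [e₁, e₂, hΩU] at h
    exact fun a => congr($(h).ofConv a)
  let e : Pushout ι p₁ ≃ₐ[k] Pushout ι p₂ := AlgEquiv.ofAlgHom Φ Γ
    (AlgHom.ext fun y => by
      obtain ⟨a, rfl⟩ := Pushout.q_surjective ι p₂ y
      obtain ⟨c, rfl⟩ : ∃ c, F c = a := ⟨F.symm a, F.apply_symm_apply a⟩
      exact (congrArg Φ (hΓx c)).trans (hΦΓ c))
    (AlgHom.ext fun y => by
      obtain ⟨a, rfl⟩ := Pushout.q_surjective ι p₁ y
      exact hΓΦ a)
  have hΩ' := counit_and_comul_of_comul_eq ((Pushout.q ι p₂).comp (F : A →ₐc[k] A)) U Ω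
    ((compat₂_iff_toConv ι p₂ hp₂ F u).1 h₂) hΩ
  refine ⟨BialgEquiv.ofAlgEquiv e ?_ ?_⟩
  · refine AlgHom.ext fun y => ?_
    obtain ⟨a, rfl⟩ := Pushout.q_surjective ι p₁ y
    exact (hΩ' a).1.trans (CoalgHomClass.counit_comp_apply (Pushout.q ι p₁) a).symm
  · refine AlgHom.ext fun y => ?_
    obtain ⟨a, rfl⟩ := Pushout.q_surjective ι p₁ y
    refine Eq.trans ?_ (hΩ' a).2.symm
    change TensorProduct.map Φ.toLinearMap Φ.toLinearMap (comul (Pushout.q ι p₁ a)) = _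
    rw [← CoalgHomClass.map_comp_comul_apply, ← LinearMap.comp_apply, ← TensorProduct.map_comp]
    rfl

end OfTriple

/-! ### Factoring Hopf algebra maps; the effect of (Z). -/

section Factor

variable {k A C K H : Type*} [Field k] [Ring A] [Ring C] [Ring K] [Ring H]

theorem exists_algHom_of_range [Algebra k A] [Algebra k C] [Algebra k K] (j : K →ₐ[k] C)
    (hj : Function.Injective j) (φ : A →ₐ[k] C) (h : ∀ a, ∃ y, j y = φ a) :
    ∃ ψ : A →ₐ[k] K, ∀ a, j (ψ a) = φ a := by
  refine ⟨(AlgEquiv.ofInjective j hj).symm.toAlgHom.comp (φ.codRestrict j.range h), fun a => ?_⟩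
  exact congrArg Subtype.val ((AlgEquiv.ofInjective j hj).apply_symm_apply
    (φ.codRestrict j.range h a))

theorem exists_bialgHom_of_range [Bialgebra k A] [Bialgebra k C] [Bialgebra k K] (j : K →ₐc[k] C)
    (hj : Function.Injective j) (φ : A →ₐc[k] C) (h : ∀ a, ∃ y, j y = φ a) :
    ∃ ψ : A →ₐc[k] K, ∀ a, j (ψ a) = φ a := by
  obtain ⟨ψ, hψ⟩ := exists_algHom_of_range (j : K →ₐ[k] C) hj (φ : A →ₐ[k] C) h
  have hψ' : ∀ a, j (ψ a) = φ a := hψ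
  refine ⟨.ofAlgHom ψ (AlgHom.ext fun a => ?_) (AlgHom.ext fun a => ?_), hψ⟩
  · change counit (R := k) (ψ a) = counit (R := k) a
    rw [← CoalgHomClass.counit_comp_apply j, hψ', CoalgHomClass.counit_comp_apply]
  · change TensorProduct.map ψ.toLinearMap ψ.toLinearMap (comul (R := k) a) = comul (R := k) (ψ a)
    -- Over a field j ⊗ j is injective, so comultiplicativity may be tested in C ⊗ C.
    apply TensorProduct.map_injective_of_flat_flat (j : K →ₗ[k] C) (j : K →ₗ[k] C) hj hj
    rw [CoalgHomClass.map_comp_comul_apply, hψ', ← CoalgHomClass.map_comp_comul_apply,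
      ← LinearMap.comp_apply, ← TensorProduct.map_comp]
    have e : (j : K →ₗ[k] C) ∘ₗ ψ.toLinearMap = (φ : A →ₗ[k] C) := LinearMap.ext hψ
    rw [e]

theorem exists_bialgEquiv_of_range {K₁ K₂ C₁ C₂ : Type*} [Ring K₁] [Bialgebra k K₁] [Ring K₂]
    [Bialgebra k K₂] [Ring C₁] [Bialgebra k C₁] [Ring C₂] [Bialgebra k C₂]
    (j₁ : K₁ →ₐc[k] C₁) (hj₁ : Function.Injective j₁) (j₂ : K₂ →ₐc[k] C₂)
    (hj₂ : Function.Injective j₂) (e : C₁ ≃ₐc[k] C₂) (h : ∀ x, ∃ y, j₂ y = e (j₁ x))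
    (h' : ∀ y, ∃ x, j₁ x = e.symm (j₂ y)) : ∃ ω : K₁ ≃ₐc[k] K₂, ∀ x, j₂ (ω x) = e (j₁ x) := by
  obtain ⟨ψ, hψ⟩ := exists_bialgHom_of_range j₂ hj₂ ((e : C₁ →ₐc[k] C₂).comp j₁) h
  obtain ⟨χ, hχ⟩ := exists_bialgHom_of_range j₁ hj₁ ((e.symm : C₂ →ₐc[k] C₁).comp j₂) h'
  have hψ' : ∀ x, j₂ (ψ x) = e (j₁ x) := hψ
  have hχ' : ∀ x, j₁ (χ x) = e.symm (j₂ x) := hχ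
  refine ⟨BialgEquiv.ofBialgHom ψ χ (BialgHom.ext fun y => hj₂ ?_) (BialgHom.ext fun x => hj₁ ?_),
    hψ⟩
  · change j₂ (ψ (χ y)) = j₂ y
    rw [hψ', hχ', e.apply_symm_apply]
  · change j₁ (χ (ψ x)) = j₁ x
    rw [hχ', hψ', e.symm_apply_apply]

theorem exists_bialgHom_of_ker [Bialgebra k A] [Bialgebra k C] [Bialgebra k H] (π : A →ₐc[k] H)
    (hπ : Function.Surjective π) (θ : A →ₐc[k] C) (h : ∀ a, π a = 0 → θ a = 0) :
    ∃ f : H →ₐc[k] C, ∀ a, f (π a) = θ a := by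
  let F : H →ₐ[k] C := (Ideal.Quotient.liftₐ (RingHom.ker (π : A →ₐ[k] H)) (θ : A →ₐ[k] C)
    (fun a ha => h a ha)).comp
    (Ideal.quotientKerAlgEquivOfSurjective (f := (π : A →ₐ[k] H)) hπ).symm.toAlgHom
  have hF : ∀ a, F (π a) = θ a := fun a =>
    congrArg (Ideal.Quotient.liftₐ (RingHom.ker (π : A →ₐ[k] H)) (θ : A →ₐ[k] C)
      (fun a ha => h a ha))
      (Ideal.quotientKerAlgEquivOfSurjective_symm_apply (f := (π : A →ₐ[k] H)) hπ a)
  refine ⟨.ofAlgHom F (AlgHom.ext fun y => ?_) (AlgHom.ext fun y => ?_), hF⟩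
  · obtain ⟨a, rfl⟩ := hπ y
    change counit (R := k) (F (π a)) = counit (R := k) (π a)
    rw [hF, CoalgHomClass.counit_comp_apply, CoalgHomClass.counit_comp_apply]
  · obtain ⟨a, rfl⟩ := hπ y
    change TensorProduct.map F.toLinearMap F.toLinearMap (comul (R := k) (π a)) =
      comul (R := k) (F (π a))
    rw [hF, ← CoalgHomClass.map_comp_comul_apply, ← CoalgHomClass.map_comp_comul_apply,
      ← LinearMap.comp_apply, ← TensorProduct.map_comp]
    have e : F.toLinearMap ∘ₗ (π : A →ₗ[k] H) = (θ : A →ₗ[k] C) := LinearMap.ext hF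
    rw [e]

/-- If `π ψ` is trivial, then the image of `ψ` consists of left coinvariants of `π`. -/
theorem map_comul_eq_of_trivial [Bialgebra k A] [Bialgebra k C] [Bialgebra k H] (π : C →ₐc[k] H)
    (ψ : A →ₐc[k] C) (h : ∀ a, π (ψ a) = algebraMap k H (counit (R := k) a)) (a : A) :
    TensorProduct.map (π : C →ₗ[k] H) LinearMap.id (comul (R := k) (ψ a)) = 1 ⊗ₜ ψ a := by
  rw [← CoalgHomClass.map_comp_comul_apply, ← LinearMap.comp_apply, ← TensorProduct.map_comp]
  have e : TensorProduct.map ((π : C →ₗ[k] H) ∘ₗ (ψ : A →ₗ[k] C))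
      (LinearMap.id ∘ₗ (ψ : A →ₗ[k] C)) =
      TensorProduct.map (Algebra.linearMap k H) (ψ : A →ₗ[k] C) ∘ₗ
        LinearMap.rTensor A (counit (R := k)) := by
    ext x y
    exact congrArg (· ⊗ₜ[k] ψ y) (h x)
  rw [e, LinearMap.comp_apply, Coalgebra.rTensor_counit_comul]
  simp

/-- Under condition (Z), a map of Hopf algebras to `H` with central image is trivial. -/
theorem ConditionZ.eq_algebraMap_counit [HopfAlgebra k K] [HopfAlgebra k H] (hZ : ConditionZ k H)
    (φ : K →ₐc[k] H) (hφ : ∀ x y, φ x * y = y * φ x) (x : K) :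
    φ x = algebraMap k H (counit (R := k) x) := by
  let D : Subalgebra k H := (φ : K →ₐ[k] H).range
  have hD : IsCentralHopfSubalgebra D := by
    refine ⟨⟨?_, ?_⟩, ?_⟩
    · rintro _ ⟨y, rfl⟩
      let ρ : K →ₗ[k] D := (φ : K →ₐ[k] H).rangeRestrict.toLinearMap
      refine ⟨TensorProduct.map ρ ρ (comul (R := k) y), ?_⟩
      rw [← LinearMap.comp_apply, ← TensorProduct.map_comp]
      exact CoalgHomClass.map_comp_comul_apply φ y
    · rintro _ ⟨y, rfl⟩
      exact ⟨antipode k y, antipode_map φ y⟩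
    · rintro _ ⟨y, rfl⟩
      exact Subalgebra.mem_center_iff.2 fun z => (hφ y z).symm
  -- The image is a central Hopf subalgebra, hence consists of scalars; the counit then identifies
  -- the scalar.
  have hx : φ x ∈ hopfCenter k H := (isGreatest_hopfCenter k H).2 hD ⟨x, rfl⟩
  rw [hZ, Algebra.mem_bot] at hx
  obtain ⟨c, hc⟩ := hx
  have h : counit (R := k) (φ x) = counit (R := k) x := CoalgHomClass.counit_comp_apply φ x
  rw [← hc, ← h, ← hc, Bialgebra.counit_algebraMap]

end Factor

/-! ### The convolution quotient of two bialgebra maps. -/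

section Difference

open WithConv

variable {k A C H : Type*} [Field k] [Ring A] [HopfAlgebra k A] [Ring C] [Bialgebra k C]
  [Ring H] [Bialgebra k H]

/-- The map `a ↦ x(S(a₍₁₎)) z(a₍₂₎)`. -/
noncomputable def convDiff (x z : A →ₐc[k] C) : A →ₗ[k] C :=
  (toConv ((x : A →ₐ[k] C).toLinearMap ∘ₗ antipode k) *
    toConv (z : A →ₐ[k] C).toLinearMap).ofConv

theorem toConv_convDiff (x z : A →ₐc[k] C) : toConv (convDiff x z) =
    toConv ((x : A →ₐ[k] C).toLinearMap ∘ₗ antipode k) * toConv (z : A →ₐ[k] C).toLinearMap :=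
  rfl

theorem toConv_mul_convDiff (x z : A →ₐc[k] C) :
    toConv (x : A →ₐ[k] C).toLinearMap * toConv (convDiff x z) =
      toConv (z : A →ₐ[k] C).toLinearMap := by
  rw [toConv_convDiff, ← mul_assoc, toConv_mul_comp_antipode, one_mul]

theorem convDiff_one (x z : A →ₐc[k] C) : convDiff x z 1 = 1 := by
  change LinearMap.mul' k C (TensorProduct.map _ _ (comul (R := k) (1 : A))) = 1
  rw [Bialgebra.comul_one, Algebra.TensorProduct.one_def]
  simp

theorem convDiff_eq_sum (x z : A →ₐc[k] C) {a : A} {α : Type*} {S : Finset α} {l r : α → A}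
    (h : comul (R := k) a = ∑ i ∈ S, l i ⊗ₜ[k] r i) :
    convDiff x z a = ∑ i ∈ S, x (antipode k (l i)) * z (r i) := by
  change LinearMap.mul' k C (TensorProduct.map _ _ (comul (R := k) a)) = _
  rw [h, map_sum, map_sum]
  rfl

/-- The antipode reverses products, so the value at ab is x(S(b₍₁₎)) · (value at a) · z(b₍₂₎);
centrality moves the middle factor out. -/
theorem convDiff_mul (x z : A →ₐc[k] C) (hc : ∀ a y, Commute (convDiff x z a) y) (a b : A) :
    convDiff x z (a * b) = convDiff x z a * convDiff x z b := by
  let R := ℛ k a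
  let S := ℛ k b
  have h : comul (R := k) (a * b) = ∑ i ∈ S.index ×ˢ R.index,
      (R.left i.2 * S.left i.1) ⊗ₜ[k] (R.right i.2 * S.right i.1) := by
    rw [Bialgebra.comul_mul, ← R.eq, ← S.eq, Finset.sum_mul_sum, Finset.sum_product,
      Finset.sum_comm]
    simp only [Algebra.TensorProduct.tmul_mul_tmul]
  rw [convDiff_eq_sum x z h, convDiff_eq_sum x z (a := b) S.eq.symm, Finset.mul_sum,
    Finset.sum_product]
  refine Finset.sum_congr rfl fun i _ => ?_
  rw [← mul_assoc, hc a, convDiff_eq_sum x z (a := a) R.eq.symm, Finset.mul_sum, Finset.sum_mul]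
  refine Finset.sum_congr rfl fun j _ => ?_
  rw [antipode_mul_antidistrib, map_mul, map_mul]
  simp only [mul_assoc]

theorem toConv_map_comul_comp {D : Type*} [Ring D] [Algebra k D] (π : C →ₐ[k] D)
    (x : A →ₐc[k] C) :
    toConv (((Algebra.TensorProduct.map π (AlgHom.id k C)).comp
        (Bialgebra.comulAlgHom k C)).toLinearMap ∘ₗ (x : A →ₐ[k] C).toLinearMap) =
      toConv ((Algebra.TensorProduct.includeLeft : D →ₐ[k] D ⊗[k] C).toLinearMap ∘ₗ
        (π.comp (x : A →ₐ[k] C)).toLinearMap) *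
      toConv ((Algebra.TensorProduct.includeRight : C →ₐ[k] D ⊗[k] C).toLinearMap ∘ₗ
        (x : A →ₐ[k] C).toLinearMap) := by
  rw [← toConv_map_comp_comul]
  congr 1
  ext a
  change TensorProduct.map π.toLinearMap LinearMap.id (comul (R := k) (x a)) = _
  rw [← CoalgHomClass.map_comp_comul_apply, ← LinearMap.comp_apply, ← TensorProduct.map_comp]
  rfl

/-- Under (π ⊗ id)Δ the quotient x⁻¹ * z becomes (rx)⁻¹ * (lπx)⁻¹ * lπz * rz, whose middle factors
cancel. -/
theorem map_comul_convDiff (π : C →ₐc[k] H) (x z : A →ₐc[k] C) (h : ∀ a, π (x a) = π (z a))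
    (a : A) : TensorProduct.map (π : C →ₗ[k] H) LinearMap.id (comul (R := k) (convDiff x z a)) =
      1 ⊗ₜ convDiff x z a := by
  let D : C →ₐ[k] H ⊗[k] C := (Algebra.TensorProduct.map (π : C →ₐ[k] H) (AlgHom.id k C)).comp
    (Bialgebra.comulAlgHom k C)
  let r : C →ₐ[k] H ⊗[k] C := Algebra.TensorProduct.includeRight
  have hx := toConv_map_comul_comp (π : C →ₐ[k] H) x
  have hz := toConv_map_comul_comp (π : C →ₐ[k] H) z
  have hxz : (π : C →ₐ[k] H).comp (z : A →ₐ[k] C) = (π : C →ₐ[k] H).comp (x : A →ₐ[k] C) :=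
    AlgHom.ext fun a => (h a).symm
  rw [hxz] at hz
  have hD := toConv_comp_mul D (toConv_convDiff x z)
  have hr := toConv_comp_mul r (toConv_convDiff x z)
  have h₁ := toConv_comp_antipode_mul (D.comp (x : A →ₐ[k] C))
  have h₂ := toConv_mul_comp_antipode (r.comp (x : A →ₐ[k] C))
  rw [AlgHom.comp_toLinearMap, LinearMap.comp_assoc] at h₁ h₂
  rw [hx, ← mul_assoc] at h₁
  have h₃ := left_inv_eq_right_inv h₁ h₂
  have hfin : toConv (D.toLinearMap ∘ₗ convDiff x z) =
      toConv (r.toLinearMap ∘ₗ convDiff x z) := by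
    rw [hD, hr, hz, ← mul_assoc, h₃]
  exact congr($(hfin).ofConv a)

/-- Here ΔU = (Δx)⁻¹ * Δz = (rx)⁻¹ * (lx)⁻¹ * lz * rz. Now (lx)⁻¹ * lz = lU and rz = rx * rU. -/
theorem toConv_comul_convDiff (x z : A →ₐc[k] C) (U : A →ₐ[k] C)
    (hU : U.toLinearMap = convDiff x z) :
    let l : C →ₐ[k] C ⊗[k] C := Algebra.TensorProduct.includeLeft
    let r : C →ₐ[k] C ⊗[k] C := Algebra.TensorProduct.includeRight
    let y : A →ₐ[k] C ⊗[k] C := r.comp (x : A →ₐ[k] C)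
    toConv (comul ∘ₗ U.toLinearMap) =
      toConv (y.toLinearMap ∘ₗ antipode k) * (toConv (l.comp U).toLinearMap *
        (toConv y.toLinearMap * toConv (r.comp U).toLinearMap)) := by
  intro l r y
  let D : C →ₐ[k] C ⊗[k] C := Bialgebra.comulAlgHom k C
  have hD' : (Algebra.TensorProduct.map (AlgHom.id k C) (AlgHom.id k C)).comp
    (Bialgebra.comulAlgHom k C) = D := by
    rw [Algebra.TensorProduct.map_id]; rfl
  have hx := toConv_map_comul_comp (AlgHom.id k C) x
  have hz := toConv_map_comul_comp (AlgHom.id k C) z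
  rw [hD', AlgHom.id_comp] at hx hz
  have hU' : toConv U.toLinearMap = toConv ((x : A →ₐ[k] C).toLinearMap ∘ₗ antipode k) *
    toConv (z : A →ₐ[k] C).toLinearMap := by rw [hU, toConv_convDiff]
  have hD := toConv_comp_mul D hU'
  have hl := toConv_comp_mul l hU'
  have hr := toConv_comp_mul r hU'
  have h₁ := toConv_comp_antipode_mul (D.comp (x : A →ₐ[k] C))
  have h₂ := toConv_mul_comp_antipode (r.comp (x : A →ₐ[k] C))
  have h₃ := toConv_mul_comp_antipode (l.comp (x : A →ₐ[k] C))
  rw [AlgHom.comp_toLinearMap, LinearMap.comp_assoc] at h₁ h₂ h₃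
  rw [hx] at h₁
  have h₄ : toConv (D.toLinearMap ∘ₗ (x : A →ₐ[k] C).toLinearMap ∘ₗ antipode k) =
      toConv (r.toLinearMap ∘ₗ (x : A →ₐ[k] C).toLinearMap ∘ₗ antipode k) *
      toConv (l.toLinearMap ∘ₗ (x : A →ₐ[k] C).toLinearMap ∘ₗ antipode k) := by
    refine left_inv_eq_right_inv h₁ ?_
    rw [mul_assoc, ← mul_assoc (toConv (r.toLinearMap ∘ₗ _)), h₂, one_mul, h₃]
  have hcom : D.toLinearMap = comul := rfl
  rw [hcom] at hD hz h₄
  rw [hD, h₄, hz, AlgHom.comp_toLinearMap, AlgHom.comp_toLinearMap, AlgHom.comp_toLinearMap, hl, hr,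
    LinearMap.comp_assoc, ← mul_assoc (toConv (r.toLinearMap ∘ₗ (x : A →ₐ[k] C).toLinearMap)), h₂,
    one_mul]
  simp only [mul_assoc, l, r]

end Difference

/-! ### From an isomorphism to a triple. -/

section Forward

open WithConv

variable {k B A H K : Type*} [Field k] [Ring B] [HopfAlgebra k B] [Ring A]
  [HopfAlgebra k A] [Ring H] [HopfAlgebra k H] [Ring K] [HopfAlgebra k K]

theorem IsExactSeq.map_eq_algebraMap {ι : B →ₐc[k] A} {π : A →ₐc[k] H} (h : IsExactSeq ι π)
    (b : B) : π (ι b) = algebraMap k H (counit (R := k) b) := by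
  have hmem : ι (b - algebraMap k B (counit (R := k) b)) ∈ RingHom.ker π := by
    rw [h.ker_eq]
    exact Ideal.subset_span ⟨_, by simp, rfl⟩
  rw [RingHom.mem_ker, map_sub, map_sub, sub_eq_zero] at hmem
  rw [hmem, AlgHomClass.commutes ι, AlgHomClass.commutes π]

theorem IsExactSeq.apply_eq_zero {ι : B →ₐc[k] A} {π : A →ₐc[k] H} (h : IsExactSeq ι π)
    {C : Type*} [Ring C] [Algebra k C] (θ : A →ₐ[k] C)
    (hθ : ∀ b, θ (ι b) = algebraMap k C (counit (R := k) b)) {a : A} (ha : π a = 0) :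
    θ a = 0 := by
  have hle : Ideal.span (ι '' {b : B | counit (R := k) b = 0}) ≤ RingHom.ker θ := by
    rw [Ideal.span_le]
    rintro _ ⟨b, hb, rfl⟩
    change θ (ι b) = 0
    rw [hθ, show counit (R := k) b = 0 from hb, map_zero]
  exact hle (h.ker_eq ▸ ha : a ∈ Ideal.span (ι '' {b : B | counit (R := k) b = 0}))

/-- A lift of an automorphism of `H` preserves the coinvariants `ι(B)`. -/
theorem IsExactSeq.exists_of_isLift {ι : B →ₐc[k] A} {π : A →ₐc[k] H} (h : IsExactSeq ι π)
    {f : H ≃ₐc[k] H} {F : A ≃ₐc[k] A} (hF : IsLift π f F) (b : B) : ∃ c, ι c = F (ι b) := by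
  have hmem : F (ι b) ∈ Set.range ι := by
    rw [h.range_eq]
    have hb : ι b ∈ Set.range ι := ⟨b, rfl⟩
    rw [h.range_eq] at hb
    let φ : A →ₗ[k] A := ((F : A →ₐc[k] A) : A →ₗ[k] A)
    change TensorProduct.map (π : A →ₗ[k] H) LinearMap.id
      (comul (R := k) ((F : A →ₐc[k] A) (ι b))) = _
    have e : TensorProduct.map (π : A →ₗ[k] H) LinearMap.id ∘ₗ
        TensorProduct.map φ φ = TensorProduct.map ((f : H →ₐc[k] H) : H →ₗ[k] H) φ ∘ₗ
          TensorProduct.map (π : A →ₗ[k] H) LinearMap.id := by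
      ext x y
      exact congrArg (· ⊗ₜ[k] F y) (hF x)
    rw [← CoalgHomClass.map_comp_comul_apply, ← LinearMap.comp_apply, e, LinearMap.comp_apply,
      show TensorProduct.map (π : A →ₗ[k] H) LinearMap.id (comul (R := k) (ι b)) = 1 ⊗ₜ ι b from hb]
    exact congrArg (· ⊗ₜ[k] F (ι b)) (map_one f)
  exact hmem

/-- The projection of the pushout to `H`. -/
theorem Pushout.exists_proj {ι : B →ₐc[k] A} {π : A →ₐc[k] H} (h : IsExactSeq ι π)
    (p : B →ₐc[k] K) : ∃ ϖ : Pushout ι p →ₐc[k] H, ∀ a, ϖ (Pushout.q ι p a) = π a := by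
  refine exists_bialgHom_of_ker (Pushout.q ι p) (Pushout.q_surjective ι p) π fun a ha => ?_
  refine pushoutIdeal_le_ker ι p (π : A →ₐ[k] H).toRingHom (fun b hb => ?_)
    ((Pushout.q_eq_zero_iff ι p).1 ha)
  change π (ι b) = 0
  rw [h.map_eq_algebraMap, ← CoalgHomClass.counit_comp_apply p, hb, map_zero, map_zero]

/-- `K` is the algebra of left coinvariants of the pushout. -/
theorem Pushout.exists_j_eq {ι : B →ₐc[k] A} {π : A →ₐc[k] H} (hexact : IsExactSeq ι π)
    (hι : IsCentralMap ι) (hnoeth : IsNoetherianRing A) (p : B →ₐc[k] K)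
    (hp : Function.Surjective p) (ϖ : Pushout ι p →ₐc[k] H)
    (hϖ : ∀ a, ϖ (Pushout.q ι p a) = π a) {y : Pushout ι p}
    (hy : TensorProduct.map (ϖ : Pushout ι p →ₗ[k] H) LinearMap.id (comul (R := k) y) =
      1 ⊗ₜ y) : ∃ x, Pushout.j ι p hp x = y := by
  obtain ⟨a, rfl⟩ := Pushout.q_surjective ι p y
  rw [← CoalgHomClass.map_comp_comul_apply, ← LinearMap.comp_apply, ← TensorProduct.map_comp] at hy
  have e : (ϖ : Pushout ι p →ₗ[k] H) ∘ₗ (Pushout.q ι p : A →ₗ[k] Pushout ι p) =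
    (π : A →ₗ[k] H) := LinearMap.ext hϖ
  rw [e, LinearMap.id_comp] at hy
  obtain ⟨b, hb⟩ := exists_q_eq_of_coinvariant ι π hexact hι hnoeth p hy
  exact ⟨p b, by rw [Pushout.j_apply, hb]⟩

variable {K₁ K₂ : Type*} [Ring K₁] [HopfAlgebra k K₁] [Ring K₂] [HopfAlgebra k K₂]

/-- Under condition (Z), an isomorphism of pushouts is trivial modulo `K₁`. -/
theorem proj_map_j {ι : B →ₐc[k] A} {π : A →ₐc[k] H} (hexact : IsExactSeq ι π)
    (hι : IsCentralMap ι) (hZ : ConditionZ k H)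
    (p₁ : B →ₐc[k] K₁) (hp₁ : Function.Surjective p₁) (p₂ : B →ₐc[k] K₂)
    (ϖ : Pushout ι p₂ →ₐc[k] H) (hϖ : ∀ a, ϖ (Pushout.q ι p₂ a) = π a)
    (e : Pushout ι p₁ ≃ₐc[k] Pushout ι p₂) (x : K₁) :
    ϖ (e (Pushout.j ι p₁ hp₁ x)) = algebraMap k H (counit (R := k) x) := by
  refine hZ.eq_algebraMap_counit
    ((ϖ.comp (e : Pushout ι p₁ →ₐc[k] Pushout ι p₂)).comp (Pushout.j ι p₁ hp₁)) (fun x y => ?_) x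
  obtain ⟨a, rfl⟩ := hexact.surjective y
  obtain ⟨z, hz⟩ : ∃ z, e z = Pushout.q ι p₂ a := ⟨e.symm _, e.apply_symm_apply _⟩
  change ϖ (e (Pushout.j ι p₁ hp₁ x)) * _ = _ * ϖ (e (Pushout.j ι p₁ hp₁ x))
  -- K₁ is central in its pushout, and the isomorphism followed by ϖ is onto H, so the image of K₁
  -- in H is central.
  rw [← hϖ, ← hz, ← map_mul, ← map_mul, (Pushout.j_commute ι hι p₁ hp₁ x z).eq, map_mul, map_mul]

/-- An isomorphism of pushouts induces an endomorphism of `H`. -/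
theorem exists_bialgHom_proj {ι : B →ₐc[k] A} {π : A →ₐc[k] H} (hexact : IsExactSeq ι π)
    (hι : IsCentralMap ι) (hZ : ConditionZ k H)
    (p₁ : B →ₐc[k] K₁) (hp₁ : Function.Surjective p₁) (p₂ : B →ₐc[k] K₂)
    (ϖ₁ : Pushout ι p₁ →ₐc[k] H) (hϖ₁ : ∀ a, ϖ₁ (Pushout.q ι p₁ a) = π a)
    (ϖ₂ : Pushout ι p₂ →ₐc[k] H) (hϖ₂ : ∀ a, ϖ₂ (Pushout.q ι p₂ a) = π a)
    (e : Pushout ι p₁ ≃ₐc[k] Pushout ι p₂) :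
    ∃ f : H →ₐc[k] H, ∀ y, f (ϖ₁ y) = ϖ₂ (e y) := by
  let θ : A →ₐc[k] H :=
    (ϖ₂.comp (e : Pushout ι p₁ →ₐc[k] Pushout ι p₂)).comp (Pushout.q ι p₁)
  have hθ : ∀ a, θ a = ϖ₂ (e (Pushout.q ι p₁ a)) := fun _ => rfl
  obtain ⟨f, hf⟩ := exists_bialgHom_of_ker π hexact.surjective θ fun a ha =>
    hexact.apply_eq_zero (θ : A →ₐ[k] H) (fun b => by
      change θ (ι b) = _
      rw [hθ, ← Pushout.j_apply ι p₁ hp₁, proj_map_j hexact hι hZ p₁ hp₁ p₂ ϖ₂ hϖ₂,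
        CoalgHomClass.counit_comp_apply]) ha
  refine ⟨f, fun y => ?_⟩
  obtain ⟨a, rfl⟩ := Pushout.q_surjective ι p₁ y
  rw [hϖ₁, hf, hθ]

theorem exists_compat_of_bialgEquiv (ι : B →ₐc[k] A) (π : A →ₐc[k] H)
    (hexact : IsExactSeq ι π) (hι : IsCentralMap ι) (hnoeth : IsNoetherianRing A)
    (hL : ConditionL π) (hZ : ConditionZ k H)
    (p₁ : B →ₐc[k] K₁) (hp₁ : Function.Surjective p₁)
    (p₂ : B →ₐc[k] K₂) (hp₂ : Function.Surjective p₂)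
    (e : Pushout ι p₁ ≃ₐc[k] Pushout ι p₂) :
    ∃ (ω : K₁ ≃ₐc[k] K₂) (g : B ≃ₐc[k] B) (u : A →ₐ[k] K₂),
      g ∈ qAut ι π ∧ Compat₁ ι p₁ p₂ ω g u ∧
      ∃ (f : H ≃ₐc[k] H) (F : A ≃ₐc[k] A),
        IsLift π f F ∧ (∀ b : B, F (ι b) = ι (g b)) ∧ Compat₂ ι p₂ hp₂ F u := by
  obtain ⟨ϖ₁, hϖ₁⟩ := Pushout.exists_proj hexact p₁
  obtain ⟨ϖ₂, hϖ₂⟩ := Pushout.exists_proj hexact p₂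
  have hinj₁ := Pushout.j_injective ι hexact.injective hι hnoeth p₁ hp₁
  have hinj₂ := Pushout.j_injective ι hexact.injective hι hnoeth p₂ hp₂
  obtain ⟨ω, hω⟩ := exists_bialgEquiv_of_range (Pushout.j ι p₁ hp₁) hinj₁ (Pushout.j ι p₂ hp₂)
    hinj₂ e
    (fun x => Pushout.exists_j_eq hexact hι hnoeth p₂ hp₂ ϖ₂ hϖ₂ (map_comul_eq_of_trivial ϖ₂
      ((e : Pushout ι p₁ →ₐc[k] Pushout ι p₂).comp (Pushout.j ι p₁ hp₁))
      (proj_map_j hexact hι hZ p₁ hp₁ p₂ ϖ₂ hϖ₂ e) x))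
    (fun y => Pushout.exists_j_eq hexact hι hnoeth p₁ hp₁ ϖ₁ hϖ₁ (map_comul_eq_of_trivial ϖ₁
      ((e.symm : Pushout ι p₂ →ₐc[k] Pushout ι p₁).comp (Pushout.j ι p₂ hp₂))
      (proj_map_j hexact hι hZ p₂ hp₂ p₁ ϖ₁ hϖ₁ e.symm) y))
  obtain ⟨f₀, hf₀⟩ := exists_bialgHom_proj hexact hι hZ p₁ hp₁ p₂ ϖ₁ hϖ₁ ϖ₂ hϖ₂ e
  obtain ⟨f₁, hf₁⟩ := exists_bialgHom_proj hexact hι hZ p₂ hp₂ p₁ ϖ₂ hϖ₂ ϖ₁ hϖ₁ e.symm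
  let f : H ≃ₐc[k] H := BialgEquiv.ofBialgHom f₀ f₁
    (BialgHom.ext fun y => by
      obtain ⟨a, rfl⟩ := hexact.surjective y
      change f₀ (f₁ (π a)) = π a
      rw [← hϖ₂, hf₁, hf₀, e.apply_symm_apply])
    (BialgHom.ext fun y => by
      obtain ⟨a, rfl⟩ := hexact.surjective y
      change f₁ (f₀ (π a)) = π a
      rw [← hϖ₁, hf₀, hf₁, e.symm_apply_apply])
  have hf : ∀ a, f (π a) = ϖ₂ (e (Pushout.q ι p₁ a)) := fun a => by
    change f₀ (π a) = _
    rw [← hϖ₁, hf₀]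
  obtain ⟨F, hF⟩ := hL f
  have hF' : IsLift π f.symm F.symm := fun a => by
    obtain ⟨c, rfl⟩ : ∃ c, F c = a := ⟨F.symm a, F.apply_symm_apply a⟩
    rw [hF c, F.symm_apply_apply, f.symm_apply_apply]
  obtain ⟨g, hg⟩ := exists_bialgEquiv_of_range ι hexact.injective ι hexact.injective F
    (hexact.exists_of_isLift hF) (hexact.exists_of_isLift hF')
  let x : A →ₐc[k] Pushout ι p₂ := (Pushout.q ι p₂).comp (F : A →ₐc[k] A)
  let z : A →ₐc[k] Pushout ι p₂ :=
    (e : Pushout ι p₁ →ₐc[k] Pushout ι p₂).comp (Pushout.q ι p₁)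
  -- F was chosen to lift the automorphism induced by e precisely for this agreement: it makes the
  -- quotient of x and z coinvariant, hence valued in K₂ and central.
  have hxz : ∀ a, ϖ₂ (x a) = ϖ₂ (z a) := fun a => (hϖ₂ (F a)).trans ((hF a).trans (hf a))
  have hrange : ∀ a, ∃ y, Pushout.j ι p₂ hp₂ y = convDiff x z a := fun a =>
    Pushout.exists_j_eq hexact hι hnoeth p₂ hp₂ ϖ₂ hϖ₂ (map_comul_convDiff ϖ₂ x z hxz a)
  have hcomm : ∀ a y, Commute (convDiff x z a) y := fun a y => by
    obtain ⟨c, hc⟩ := hrange a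
    rw [← hc]
    exact Pushout.j_commute ι hι p₂ hp₂ c y
  let U : A →ₐ[k] Pushout ι p₂ :=
    .ofLinearMap (convDiff x z) (convDiff_one x z) (convDiff_mul x z hcomm)
  obtain ⟨u, hu⟩ := exists_algHom_of_range (Pushout.j ι p₂ hp₂ : K₂ →ₐ[k] Pushout ι p₂) hinj₂ U
    hrange
  have hU : (Pushout.j ι p₂ hp₂ : K₂ →ₐ[k] Pushout ι p₂).comp u = U := AlgHom.ext hu
  refine ⟨ω, g, u, Subgroup.subset_closure ⟨f, F, hF, fun b => (hg b).symm⟩, fun b => hinj₂ ?_,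
    f, F, hF, fun b => (hg b).symm, ?_⟩
  -- The first identity is x * (x⁻¹ * z) = z restricted to B, read in the pushout through the
  -- injective j₂.
  · have h₁ : toConv ((p₂ : B →ₗ[k] K₂) ∘ₗ (g : B →ₗ[k] B)) *
        toConv (u.toLinearMap ∘ₗ (ι : B →ₗ[k] A)) =
        toConv (compatMap₁ ι p₂ g u ∘ₗ comul) := rfl
    have h₂ := toConv_comp_mul (Pushout.j ι p₂ hp₂ : K₂ →ₐ[k] Pushout ι p₂) h₁.symm
    have h₃ := toConv_mul_comp ι (toConv_mul_convDiff x z).symm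
    have e₁ : (x : A →ₐ[k] Pushout ι p₂).toLinearMap ∘ₗ (ι : B →ₗ[k] A) =
        (Pushout.j ι p₂ hp₂ : K₂ →ₐ[k] Pushout ι p₂).toLinearMap ∘ₗ (p₂ : B →ₗ[k] K₂) ∘ₗ
          (g : B →ₗ[k] B) :=
      LinearMap.ext fun b => (congrArg (Pushout.q ι p₂) (hg b).symm).trans
        (Pushout.j_apply ι p₂ hp₂ (g b)).symm
    have e₂ : (Pushout.j ι p₂ hp₂ : K₂ →ₐ[k] Pushout ι p₂).toLinearMap ∘ₗ u.toLinearMap ∘ₗ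
        (ι : B →ₗ[k] A) = convDiff x z ∘ₗ (ι : B →ₗ[k] A) :=
      LinearMap.ext fun b => hu (ι b)
    rw [e₁] at h₃
    rw [e₂, ← h₃] at h₂
    have h := congr($(h₂).ofConv b)
    refine Eq.trans ?_ h.symm
    rw [hω, Pushout.j_apply]
    rfl
  · refine (compat₂_iff_toConv ι p₂ hp₂ F u).2 ?_
    rw [hU]
    exact toConv_comul_convDiff x z U rfl

end Forward

end HopfExt

open HopfExt in
theorem theorem2 {k : Type*} [Field k] {B A H K₁ K₂ : Type*}
    [Ring B] [HopfAlgebra k B] [Ring A] [HopfAlgebra k A] [Ring H] [HopfAlgebra k H]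
    [Ring K₁] [HopfAlgebra k K₁] [Ring K₂] [HopfAlgebra k K₂]
    (hS : Function.Bijective (HopfAlgebra.antipode k (A := A)))
    (ι : B →ₐc[k] A) (π : A →ₐc[k] H)
    (hexact : IsExactSeq ι π) (hcentral : IsCentralMap ι) (hnoeth : IsNoetherianRing A)
    (hL : ConditionL π) (hZ : ConditionZ k H)
    (p₁ : B →ₐc[k] K₁) (hp₁ : Function.Surjective p₁)
    (p₂ : B →ₐc[k] K₂) (hp₂ : Function.Surjective p₂) :
    Nonempty (Pushout ι p₁ ≃ₐc[k] Pushout ι p₂) ↔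
      ∃ (ω : K₁ ≃ₐc[k] K₂) (g : B ≃ₐc[k] B) (u : A →ₐ[k] K₂),
        g ∈ qAut ι π ∧
        Compat₁ ι p₁ p₂ ω g u ∧
        ∃ (f : H ≃ₐc[k] H) (F : A ≃ₐc[k] A),
          IsLift π f F ∧ (∀ b : B, F (ι b) = ι (g b)) ∧ Compat₂ ι p₂ hp₂ F u := by
  constructor
  · rintro ⟨e⟩
    exact exists_compat_of_bialgEquiv ι π hexact hcentral hnoeth hL hZ p₁ hp₁ p₂ hp₂ e
  · rintro ⟨ω, g, u, -, h₁, f, F, -, hF, h₂⟩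
    exact nonempty_bialgEquiv_of_compat ι hcentral p₁ hp₁ p₂ hp₂ ω g u F h₁ hF h₂
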